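/- Let $\Sigma,\Gamma$ be finite alphabets and let $f:\Sigma^\omega\rightharpoonup\Gamma^\omega$ be a partial function with domain $\mathrm{dom}(f)$. Suppose that $f$ is regular, i.e. realized by a deterministic two-way Muller transducer with look-around: a finite-state device on the tape ${\vdash}a_1a_2\dots$, starting on $\vdash$, whose transitions depend on the current state, the symbol under the head, the state reached by a look-behind DFA on the part of the tape to the left of the head, and a state $p$ of a one-way look-ahead Muller automaton $A$ such that the tape content from the head position on is in $L(A,p)$ (in each configuration at most one such $p$ enables a transition); a transition changes the state, appends a finite word over $\Gamma$ to the output, and moves the head by $\pm1$. The domain of $f$ is the set of words on which the run is infinite, visits arbitrarily large positions, and has its set of infinitely repeated states in the Muller family; on these words the output is infinite and equals $f(w)$. Say that $f$ is computable if there is a deterministic machine $M$ with a read-only one-way input tape, a two-way work tape, and a write-only one-way output tape (the tapes have a left delimiter and are infinite to the right) such that for all $x\in\mathrm{dom}(f)$ and all $i\ge 0$ there is $j\ge 0$ such that the prefix of length $i$ of $f(x)$ is a prefix of $M(x,j)$, where $M(x,j)$ is the output produced by $M$ on $x$ until its input head moves from position $j$ to position $j+1$ (and is the empty word if this move never happens).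 Then $f$ is computable if and only if $f$ is continuous on $\mathrm{dom}(f)$ for the Cantor topologies of $\Sigma^\omega$ and $\Gamma^\omega$. Moreover, the mismatch problem of $f$ is decidable: there is an algorithm that, given $u\in\Sigma^*$ and $v\in\Gamma^*$, decides whether there is $y\in\Sigma^\omega$ such that $uy\in\mathrm{dom}(f)$ and $v$ differs from $f(uy)$ at some position $i\le |v|$. -/

import Mathlib

open Filter

/-! ### Words

An infinite word over `α` is a function `ℕ → α`; `ℕ → α` carries the product of the discrete
topologies, that is, the Cantor topology. A partial function on infinite words is a
`PFun`, written `(ℕ → Sig) →. (ℕ → Gam)`. -/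

/-- The content `⊢ a₁ a₂ …` of an input tape: cell `0` holds the left delimiter (`none`),
cell `i + 1` holds the `i`-th letter (counted from `0`) of the infinite word. -/
def inputTape {α : Type*} (w : ℕ → α) : ℕ → Option α
  | 0 => none
  | i + 1 => some (w i)

/-- The prefix of length `k` of an infinite word. -/
def wordPrefix {α : Type*} (w : ℕ → α) (k : ℕ) : List α :=
  (List.range k).map w

/-- The set of values that a sequence takes infinitely often. -/
def infSet {α : Type*} (ρ : ℕ → α) : Set α :=
  {s | ∃ᶠ n in atTop, ρ n = s}

/-! ### Regular functions: deterministic two-way Muller transducers with look-around -/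

/-- A (nondeterministic) one-way automaton on infinite words with a Muller acceptance
condition. No initial state is singled out, since as a look-ahead it is started
in each of its states. -/
structure MullerAutomaton (α : Type*) (S : Type*) where
  step : S → α → Set S
  acc : Set (Set S)

/-- `L(A, p)`: the infinite words having a final run that starts in `p`. -/
def MullerAutomaton.langFrom {α S : Type*} (A : MullerAutomaton α S) (p : S) : Set (ℕ → α) :=
  {w | ∃ ρ : ℕ → S, ρ 0 = p ∧ (∀ n, ρ (n + 1) ∈ A.step (ρ n) (w n)) ∧ infSet ρ ∈ A.acc}

/-- Directions of the head of a two-way transducer. -/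
inductive HeadDir
  | left
  | right

/-- A two-way transducer with look-around, Muller acceptance condition, and a partial
transition function. A transition may depend on the current state, on the symbol under the head,
on a state of the look-ahead automaton, and on the state that the look-behind automaton
reaches on the part of the tape strictly to the left of the head
(so the accepting states of the look-behind automaton play no role).
Determinism is the predicate `IsDeterministic` below. -/
structure TwoWayTransducer (Sig : Type*) (Gam : Type*) where
  State : Type
  Ahead : Type
  Behind : Type
  finState : Finite State
  finAhead : Finite Ahead
  finBehind : Finite Behind
  init : State
  lookAhead : MullerAutomaton (Option Sig) Ahead
  lookBehind : DFA (Option Sig) Behind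
  trans : State → Option Sig → Ahead → Behind → Option (State × List Gam × HeadDir)
  acc : Set (Set State)

namespace TwoWayTransducer

variable {Sig Gam : Type*} (T : TwoWayTransducer Sig Gam)

/-- State of the look-behind automaton after the tape cells `0, …, i - 1`. -/
def behindState (w : ℕ → Sig) (i : ℕ) : T.Behind :=
  T.lookBehind.eval (wordPrefix (inputTape w) i)

/-- The content of the tape from cell `i` on is in the look-ahead language of `p`. -/
def AheadHolds (w : ℕ → Sig) (i : ℕ) (p : T.Ahead) : Prop :=
  (fun n => inputTape w (i + n)) ∈ T.lookAhead.langFrom p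

/-- The transition that is taken in configuration `(q, i)` with look-ahead state `p`. -/
def transAt (w : ℕ → Sig) (q : T.State) (i : ℕ) (p : T.Ahead) :
    Option (T.State × List Gam × HeadDir) :=
  T.trans q (inputTape w i) p (T.behindState w i)

/-- On every input, in every configuration, at most one look-ahead state both accepts
the remaining input and enables a transition. -/
def IsDeterministic : Prop :=
  ∀ (w : ℕ → Sig) (q : T.State) (i : ℕ) (p p' : T.Ahead),
    T.AheadHolds w i p → T.AheadHolds w i p' →
    (T.transAt w q i p).isSome → (T.transAt w q i p').isSome → p = p'

/-- `(q, i)` is followed by `(q', i')` with output `γ`. A move to the left of the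
left delimiter is impossible. -/
def Step (w : ℕ → Sig) (c : T.State × ℕ) (γ : List Gam) (c' : T.State × ℕ) : Prop :=
  ∃ p, T.AheadHolds w c.2 p ∧
    ((T.transAt w c.1 c.2 p = some (c'.1, γ, HeadDir.right) ∧ c'.2 = c.2 + 1) ∨
     (T.transAt w c.1 c.2 p = some (c'.1, γ, HeadDir.left) ∧ c.2 = c'.2 + 1))

/-- An accepting run with configurations `ρ` and outputs `γ`: an infinite run from the initial
configuration that reads the whole input and satisfies the Muller condition. -/
structure IsAcceptingRun (w : ℕ → Sig) (ρ : ℕ → T.State × ℕ) (γ : ℕ → List Gam) : Prop where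
  start : ρ 0 = (T.init, 0)
  step : ∀ n, T.Step w (ρ n) (γ n) (ρ (n + 1))
  readsAll : ∀ k, ∃ n, k ≤ (ρ n).2
  muller : infSet (fun n => (ρ n).1) ∈ T.acc

end TwoWayTransducer

/-- The infinite concatenation `γ 0 ++ γ 1 ++ …` is the infinite word `v`. -/
def ConcatEq {α : Type*} (γ : ℕ → List α) (v : ℕ → α) : Prop :=
  (∀ n, ∃ k, (List.range n).flatMap γ = wordPrefix v k) ∧
  ∀ k, ∃ n, k ≤ ((List.range n).flatMap γ).length

/-- `T` realizes `f`: the domain of `f` consists of the words with an accepting run,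
and such a run outputs the (infinite) word `f w`. -/
def TwoWayTransducer.Realizes {Sig Gam : Type*} (T : TwoWayTransducer Sig Gam)
    (f : (ℕ → Sig) →. (ℕ → Gam)) : Prop :=
  (∀ w, w ∈ f.Dom ↔ ∃ ρ γ, T.IsAcceptingRun w ρ γ) ∧
  ∀ w ρ γ, T.IsAcceptingRun w ρ γ → ∀ v ∈ f w, ConcatEq γ v

/-- Regular functions on infinite words: those realized by a deterministic two-way Muller
transducer with look-around. -/
def IsRegularFunction {Sig Gam : Type*} (f : (ℕ → Sig) →. (ℕ → Gam)) : Prop :=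
  ∃ T : TwoWayTransducer Sig Gam, T.IsDeterministic ∧ T.Realizes f

/-! ### Computable functions: deterministic machines with three tapes -/

/-- Moves of the head on the work tape. -/
inductive WorkMove
  | left
  | stay
  | right

/-- What a machine does in one step: the next state, the symbol written on the work tape, the move
on the work tape, whether the input head advances by one cell, and the symbol (if any)
appended to the output tape. -/
structure MachineAction (State Work Gam : Type*) where
  next : State
  write : Work
  move : WorkMove
  advance : Bool
  out : Option Gam

/-- A deterministic machine with a read-only one-way input tape, a two-way work tape and a
write-only one-way output tape. The symbol `none` read on the input or on the work tape is
the left delimiter. -/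
structure StreamMachine (Sig : Type*) (Gam : Type*) where
  State : Type
  Work : Type
  finState : Finite State
  finWork : Finite Work
  blank : Work
  init : State
  trans : State → Option Sig → Option Work → Option (MachineAction State Work Gam)

namespace StreamMachine

variable {Sig Gam : Type*} (M : StreamMachine Sig Gam)

/-- Configurations. On the work tape the delimiter is at position `0`, and position `k + 1`
holds `cells k`. -/
structure Config where
  state : M.State
  inPos : ℕ
  cells : ℕ → M.Work
  workPos : ℕ
  output : List Gam

/-- Start: both heads are on the left delimiters, the work tape is blank, no output. -/
def initConfig : M.Config :=
  ⟨M.init, 0, fun _ => M.blank, 0, []⟩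

/-- The symbol of the work tape at position `k`. -/
def readWork (cells : ℕ → M.Work) : ℕ → Option M.Work
  | 0 => none
  | k + 1 => some (cells k)

/-- Write on the work tape at position `k`; the delimiter cannot be overwritten. -/
def writeWork (cells : ℕ → M.Work) (s : M.Work) : ℕ → (ℕ → M.Work)
  | 0 => cells
  | k + 1 => Function.update cells k s

/-- Move on the work tape; a left move on the delimiter has no effect. -/
def movedPos (k : ℕ) : WorkMove → ℕ
  | WorkMove.left => k - 1
  | WorkMove.stay => k
  | WorkMove.right => k + 1

/-- One step on input `x`; where no transition is defined, the machine stops. -/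
def step (x : ℕ → Sig) (c : M.Config) : M.Config :=
  match M.trans c.state (inputTape x c.inPos) (M.readWork c.cells c.workPos) with
  | none => c
  | some a =>
    { state := a.next
      inPos := if a.advance then c.inPos + 1 else c.inPos
      cells := M.writeWork c.cells a.write c.workPos
      workPos := movedPos c.workPos a.move
      output := c.output ++ a.out.toList }

/-- The configuration after `n` steps on input `x`. -/
def configAt (x : ℕ → Sig) (n : ℕ) : M.Config :=
  (M.step x)^[n] M.initConfig

open Classical in
/-- `M(x, j)`: the output produced until the input head moves from position `j` to position
`j + 1`, and the empty word if this never happens. -/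
noncomputable def outputUpTo (x : ℕ → Sig) (j : ℕ) : List Gam :=
  if h : ∃ n, (M.configAt x n).inPos = j + 1 then (M.configAt x (Nat.find h)).output else []

/-- `M` computes `f`: on every `x` in the domain of `f`, every prefix of `f x` is a prefix
of some `M(x, j)`. -/
def Computes (f : (ℕ → Sig) →. (ℕ → Gam)) : Prop :=
  ∀ x, ∀ y ∈ f x, ∀ i, ∃ j, wordPrefix y i <+: M.outputUpTo x j

end StreamMachine

/-- Computable functions on infinite words. -/
def IsComputableFunction {Sig Gam : Type*} (f : (ℕ → Sig) →. (ℕ → Gam)) : Prop :=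
  ∃ M : StreamMachine Sig Gam, M.Computes f

/-! ### The mismatch problem -/

/-- Some extension `x` of `u` in the domain of `f` is such that `v` and `f x` differ at some
position of `v`. -/
def HasMismatch {Sig Gam : Type*} (f : (ℕ → Sig) →. (ℕ → Gam)) (u : List Sig) (v : List Gam) :
    Prop :=
  ∃ x, ∃ z ∈ f x, u = wordPrefix x u.length ∧ ∃ i, ∃ h : i < v.length, v[i] ≠ z i

/-- The mismatch problem of `f` (given `u` and `v`, does `HasMismatch f u v` hold?) is decidable.
The letters of the finite alphabets are presented as numbers, in any way. -/
def MismatchDecidable {Sig Gam : Type*} (f : (ℕ → Sig) →. (ℕ → Gam)) : Prop :=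
  ∀ (n m : ℕ) (e : Fin n ≃ Sig) (e' : Fin m ≃ Gam),
    ComputablePred fun p : List (Fin n) × List (Fin m) =>
      HasMismatch f (p.1.map e) (p.2.map e')

/-!
A continuous `f` determines the letter at position `i` of `f x` from a finite prefix of `x`, so a
machine computes `f` as soon as it can decide, given a prefix `u` and a position `i`, which letters
occur at position `i` of `f y` for some extension `y` of `u`. To decide this, an accepting run of a
transducer, with a distinguished letter of its output, is described by labels of the tape cells: a
label records the states in which the head visits the cell, the order of these visits, and whether
they come before or after the output of the letter. Correctness of the labels is a condition on
neighbouring cells together with a condition that does not change when the first cell is removed,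
and the position of the letter in the output is the sum of weights attached to the labels. Hence the
possible letters are given by the accepting paths with prescribed total weight in a finite graph.
The set of vertices that start an accepting path of total weight `n` is a function of such sets for
finitely many smaller weights, so a finite automaton that reads `n` in unary computes it; the finite
table of this automaton is all that the algorithm has to know about the acceptance condition.
-/

/-! ### Words and sequences -/

section Words

variable {α : Type*}

/-- The sequence `a, w 0, w 1, …`: it extends a word by a letter and a run by a first state. -/
def consWord (a : α) (w : ℕ → α) : ℕ → α
  | 0 => a
  | n + 1 => w n

theorem wordPrefix_succ (w : ℕ → α) (k : ℕ) : wordPrefix w (k + 1) = wordPrefix w k ++ [w k] := by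
  simp [wordPrefix, List.range_succ]

@[simp] theorem length_wordPrefix (w : ℕ → α) (k : ℕ) : (wordPrefix w k).length = k := by
  simp [wordPrefix]

theorem getElem?_wordPrefix (w : ℕ → α) {i k : ℕ} (h : i < k) :
    (wordPrefix w k)[i]? = some (w i) := by
  simp [wordPrefix, h]

theorem wordPrefix_eq_wordPrefix_iff {w w' : ℕ → α} {k : ℕ} :
    wordPrefix w k = wordPrefix w' k ↔ ∀ i < k, w i = w' i := by
  simp [wordPrefix, List.map_inj_left]

theorem wordPrefix_prefix_wordPrefix (w : ℕ → α) {k l : ℕ} (h : k ≤ l) :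
    wordPrefix w k <+: wordPrefix w l :=
  List.prefix_iff_eq_take.2 (by simp [wordPrefix, ← List.map_take, List.take_range, h])

theorem length_flatMap_range (γ : ℕ → List α) (n : ℕ) :
    ((List.range n).flatMap γ).length = ∑ t ∈ Finset.range n, (γ t).length := by
  induction n with
  | zero => rfl
  | succ n ih => simp [List.range_succ, ih, Finset.sum_range_succ]

theorem ConcatEq.apply_eq {γ : ℕ → List α} {v : ℕ → α} (h : ConcatEq γ v) {t o : ℕ} {c : α}
    (hc : (γ t)[o]? = some c) : v (∑ s ∈ Finset.range t, (γ s).length + o) = c := by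
  obtain ⟨k, hk⟩ := h.1 (t + 1)
  have ho : o < (γ t).length := (List.getElem?_eq_some_iff.1 hc).1
  have hlength := congrArg List.length hk
  rw [length_flatMap_range, length_wordPrefix, Finset.sum_range_succ] at hlength
  have hv := getElem?_wordPrefix v (show ∑ s ∈ Finset.range t, (γ s).length + o < k by omega)
  rw [← hk, List.range_succ, List.flatMap_append, ← length_flatMap_range,
    List.getElem?_append_right (by omega)] at hv
  rw [← length_flatMap_range]
  simpa [hc] using hv.symm

theorem ConcatEq.exists_index {γ : ℕ → List α} {v : ℕ → α} (h : ConcatEq γ v) (i : ℕ) :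
    ∃ t o, ∑ s ∈ Finset.range t, (γ s).length + o = i ∧ (γ t)[o]? = some (v i) := by
  obtain ⟨n, hn⟩ := h.2 (i + 1)
  rw [length_flatMap_range] at hn
  induction n with
  | zero => simp at hn
  | succ n ih =>
    by_cases hi : i + 1 ≤ ∑ s ∈ Finset.range n, (γ s).length
    · exact ih hi
    · rw [Finset.sum_range_succ] at hn
      obtain ⟨o, rfl⟩ := Nat.exists_eq_add_of_le (show ∑ s ∈ Finset.range n, (γ s).length ≤ i by
        omega)
      have ho : (γ n)[o]? = some (γ n)[o] := List.getElem?_eq_getElem (by omega)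
      exact ⟨n, o, rfl, by rw [h.apply_eq ho, ho]⟩

theorem infSet_tail (ρ : ℕ → α) : infSet (fun n => ρ (n + 1)) = infSet ρ := by
  ext s
  simp only [infSet, Set.mem_ofPred_eq]
  rw [← frequently_map (m := fun n : ℕ => n + 1) (P := fun n => ρ n = s), map_add_atTop_eq_nat]

theorem MullerAutomaton.mem_langFrom_iff {S : Type*} (A : MullerAutomaton α S) (p : S)
    (w : ℕ → α) :
    w ∈ A.langFrom p ↔ ∃ p' ∈ A.step p (w 0), (fun n => w (n + 1)) ∈ A.langFrom p' := by
  constructor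
  · rintro ⟨ρ, rfl, hstep, hacc⟩
    exact ⟨ρ 1, hstep 0, fun n => ρ (n + 1), rfl, fun n => hstep (n + 1), by rwa [infSet_tail]⟩
  · rintro ⟨p', hp', ρ, rfl, hstep, hacc⟩
    refine ⟨consWord p ρ, rfl, ?_, by rwa [← infSet_tail]⟩
    rintro (_ | n)
    exacts [hp', hstep n]

theorem injective_of_infinite_range {ρ : ℕ → α} (hρ : ∀ m n, ρ m = ρ n → ρ (m + 1) = ρ (n + 1))
    (hinf : (Set.range ρ).Infinite) : Function.Injective ρ := by
  refine .of_lt_imp_ne fun m n hmn heq => hinf ?_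
  have hperiod : ∀ j, ρ (m + j) = ρ (n + j) := fun j => by
    induction j with
    | zero => exact heq
    | succ j ih => exact hρ _ _ ih
  refine ((Set.finite_lt_nat n).image ρ).subset (Set.range_subset_iff.2 fun t => ?_)
  induction t using Nat.strong_induction_on with
  | _ t ih =>
    by_cases ht : t < n
    · exact ⟨t, ht, rfl⟩
    · obtain ⟨j, rfl⟩ := Nat.exists_eq_add_of_le (not_lt.1 ht)
      rw [← hperiod]
      exact ih (m + j) (by omega)

end Words

/-! ### Continuity and forced output letters -/

section ForcedLetters

variable {Sig Gam : Type*} {f : (ℕ → Sig) →. (ℕ → Gam)}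

/-- The letters at position `i` of the values of `f` on the words that extend `u`. They decide
both mismatches and continuity. -/
def outputLetters (f : (ℕ → Sig) →. (ℕ → Gam)) (u : List Sig) (i : ℕ) : Set Gam :=
  {c | ∃ x, ∃ y ∈ f x, u = wordPrefix x u.length ∧ y i = c}

theorem mem_outputLetters_wordPrefix {x : ℕ → Sig} {k i : ℕ} {c : Gam} :
    c ∈ outputLetters f (wordPrefix x k) i ↔
      ∃ x', ∃ y' ∈ f x', (∀ j < k, x' j = x j) ∧ y' i = c := by
  simp only [outputLetters, Set.mem_ofPred_eq, length_wordPrefix, wordPrefix_eq_wordPrefix_iff,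
    eq_comm (a := x _)]

theorem apply_mem_outputLetters {x : ℕ → Sig} {y : ℕ → Gam} (hy : y ∈ f x) (k i : ℕ) :
    y i ∈ outputLetters f (wordPrefix x k) i :=
  mem_outputLetters_wordPrefix.2 ⟨x, y, hy, fun _ _ => rfl, rfl⟩

theorem outputLetters_wordPrefix_anti (x : ℕ → Sig) {k l : ℕ} (h : k ≤ l) (i : ℕ) :
    outputLetters f (wordPrefix x l) i ⊆ outputLetters f (wordPrefix x k) i := by
  intro c hc
  rw [mem_outputLetters_wordPrefix] at hc ⊢
  obtain ⟨x', y', hy', hx', rfl⟩ := hc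
  exact ⟨x', y', hy', fun j hj => hx' j (hj.trans_le h), rfl⟩

theorem outputLetters_eq_singleton_iff {x : ℕ → Sig} {y : ℕ → Gam} (hy : y ∈ f x) {k i : ℕ} :
    outputLetters f (wordPrefix x k) i = {y i} ↔
      ∀ x', ∀ y' ∈ f x', (∀ j < k, x' j = x j) → y' i = y i := by
  rw [Set.Nonempty.subset_singleton_iff ⟨_, apply_mem_outputLetters hy k i⟩ |>.symm]
  constructor
  · exact fun h x' y' hy' hx' => h (mem_outputLetters_wordPrefix.2 ⟨x', y', hy', hx', rfl⟩)
  · rintro h c hc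
    obtain ⟨x', y', hy', hx', rfl⟩ := mem_outputLetters_wordPrefix.1 hc
    exact h x' y' hy' hx'

theorem continuous_asSubtype_iff [TopologicalSpace Sig] [DiscreteTopology Sig]
    [TopologicalSpace Gam] [DiscreteTopology Gam] :
    Continuous f.asSubtype ↔
      ∀ x, ∀ y ∈ f x, ∀ i, ∃ k, outputLetters f (wordPrefix x k) i = {y i} := by
  simp only [continuous_pi_iff, continuous_discrete_rng, isOpen_iff_mem_nhds, Subtype.forall]
  constructor
  · intro h x y hy i
    have hx : x ∈ f.Dom := Part.dom_iff_mem.2 ⟨y, hy⟩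
    have hnhds := h i (y i) x hx (by simp [PFun.asSubtype_eq_of_mem hy hx])
    obtain ⟨U, hU, hUsub⟩ := mem_nhds_subtype _ _ _ |>.1 hnhds
    obtain ⟨_, ⟨z, k, rfl⟩, hxz, hsub⟩ :=
      (PiNat.isTopologicalBasis_cylinders fun _ : ℕ => Sig).mem_nhds_iff.1 hU
    refine ⟨k, (outputLetters_eq_singleton_iff hy).2 fun x' y' hy' hx' => ?_⟩
    have hdom : x' ∈ f.Dom := Part.dom_iff_mem.2 ⟨y', hy'⟩
    rw [← PiNat.mem_cylinder_iff_eq.1 hxz] at hsub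
    simpa [PFun.asSubtype_eq_of_mem hy' hdom] using
      hUsub (show (⟨x', hdom⟩ : f.Dom) ∈ Subtype.val ⁻¹' U from hsub hx')
  · rintro h i c x hx rfl
    obtain ⟨y, hy⟩ := Part.dom_iff_mem.1 hx
    obtain ⟨k, hk⟩ := h x y hy i
    refine (mem_nhds_subtype _ _ _).2 ⟨PiNat.cylinder x k,
      (PiNat.isOpen_cylinder _ x k).mem_nhds (PiNat.self_mem_cylinder x k), ?_⟩
    rintro ⟨x', hdom⟩ hx'
    obtain ⟨y', hy'⟩ := Part.dom_iff_mem.1 hdom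
    simpa [PFun.asSubtype_eq_of_mem hy hx, PFun.asSubtype_eq_of_mem hy' hdom] using
      (outputLetters_eq_singleton_iff hy).1 hk x' y' hy' hx'

theorem hasMismatch_iff {u : List Sig} {v : List Gam} :
    HasMismatch f u v ↔ ∃ i < v.length, ∃ c ∈ outputLetters f u i, v[i]? ≠ some c := by
  constructor
  · rintro ⟨x, y, hy, hu, i, hi, hne⟩
    exact ⟨i, hi, y i, ⟨x, y, hy, hu, rfl⟩, by simpa [List.getElem?_eq_getElem hi] using hne⟩
  · rintro ⟨i, hi, _, ⟨x, y, hy, hu, rfl⟩, hne⟩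
    exact ⟨x, y, hy, hu, i, hi, by simpa [List.getElem?_eq_getElem hi] using hne⟩

open Classical in
/-- The element of `C`, if `C` has exactly one element. -/
noncomputable def onlyElement {α : Type*} (C : Set α) : Option α :=
  if h : ∃ c, C = {c} then some h.choose else none

theorem onlyElement_eq_some_iff {α : Type*} {C : Set α} {c : α} :
    onlyElement C = some c ↔ C = {c} := by
  unfold onlyElement
  split_ifs with h
  · rw [Option.some_inj, ← Set.singleton_eq_singleton_iff, ← h.choose_spec]
  · exact ⟨nofun, fun hC => absurd ⟨c, hC⟩ h⟩

/-- The output that is emitted when, after each letter of the input `w`, the next output letter is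
appended as soon as the letters read so far determine it. -/
noncomputable def predicted (f : (ℕ → Sig) →. (ℕ → Gam)) (w : ℕ → Sig) : ℕ → List Gam
  | 0 => []
  | k + 1 => predicted f w k ++
      (onlyElement (outputLetters f (wordPrefix w k) (predicted f w k).length)).toList

theorem predicted_eq_wordPrefix {x : ℕ → Sig} {y : ℕ → Gam} (hy : y ∈ f x) (k : ℕ) :
    predicted f x k = wordPrefix y (predicted f x k).length := by
  induction k with
  | zero => rfl
  | succ k ih =>
    rw [predicted]
    cases h : onlyElement (outputLetters f (wordPrefix x k) (predicted f x k).length) with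
    | none => simpa using ih
    | some c =>
      have hc := apply_mem_outputLetters hy k (predicted f x k).length
      rw [onlyElement_eq_some_iff.1 h, Set.mem_singleton_iff] at hc
      simp only [Option.toList_some, List.length_append, List.length_singleton]
      rw [wordPrefix_succ, ← ih, hc]

theorem monotone_length_predicted (f : (ℕ → Sig) →. (ℕ → Gam)) (x : ℕ → Sig) :
    Monotone fun k => (predicted f x k).length :=
  monotone_nat_of_le_succ fun k => by simp [predicted]

theorem exists_le_length_predicted {x : ℕ → Sig} {y : ℕ → Gam} (hy : y ∈ f x)
    (hforced : ∀ i, ∃ k, outputLetters f (wordPrefix x k) i = {y i}) (i : ℕ) :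
    ∃ k, i ≤ (predicted f x k).length := by
  induction i with
  | zero => exact ⟨0, Nat.zero_le _⟩
  | succ i ih =>
    obtain ⟨k, hk⟩ := ih
    obtain ⟨l, hl⟩ := hforced i
    have hmono : i ≤ (predicted f x (max k l)).length :=
      hk.trans (monotone_length_predicted f x (le_max_left k l))
    rcases hmono.lt_or_eq with hlt | heq
    · exact ⟨_, hlt⟩
    have hsingle : outputLetters f (wordPrefix x (max k l)) i = {y i} :=
      (Set.Nonempty.subset_singleton_iff ⟨_, apply_mem_outputLetters hy _ i⟩).1
        ((outputLetters_wordPrefix_anti x (le_max_right k l) i).trans hl.subset)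
    refine ⟨max k l + 1, ?_⟩
    rw [predicted, ← heq, onlyElement_eq_some_iff.2 hsingle]
    simp [← heq]

end ForcedLetters

/-! ### Computable functions are continuous -/

namespace StreamMachine

variable {Sig Gam : Type*} (M : StreamMachine Sig Gam)

theorem configAt_succ (x : ℕ → Sig) (n : ℕ) :
    M.configAt x (n + 1) = M.step x (M.configAt x n) :=
  Function.iterate_succ_apply' _ _ _

theorem inPos_step (x : ℕ → Sig) (c : M.Config) :
    (M.step x c).inPos = c.inPos ∨ (M.step x c).inPos = c.inPos + 1 := by
  unfold step
  split
  · exact Or.inl rfl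
  · simp only
    split_ifs
    exacts [Or.inr rfl, Or.inl rfl]

theorem monotone_inPos (x : ℕ → Sig) : Monotone fun n => (M.configAt x n).inPos :=
  monotone_nat_of_le_succ fun n => by
    rw [configAt_succ]
    rcases M.inPos_step x (M.configAt x n) with h | h <;> omega

theorem output_prefix_output_step (x : ℕ → Sig) (c : M.Config) :
    c.output <+: (M.step x c).output := by
  unfold step
  split
  exacts [List.prefix_rfl, List.prefix_append _ _]

theorem output_prefix_of_le (x : ℕ → Sig) {m n : ℕ} (h : m ≤ n) :
    (M.configAt x m).output <+: (M.configAt x n).output := by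
  induction n, h using Nat.le_induction with
  | base => exact List.prefix_rfl
  | succ n _ ih =>
    rw [configAt_succ]
    exact ih.trans (M.output_prefix_output_step _ _)

/-- The input head moves from position `j` to position `j + 1` in the step after time `n`. -/
def Crosses (x : ℕ → Sig) (j n : ℕ) : Prop :=
  (M.configAt x n).inPos = j ∧ (M.configAt x (n + 1)).inPos = j + 1

variable {M}

theorem Crosses.inPos_le {x : ℕ → Sig} {j n : ℕ} (h : M.Crosses x j n) {m : ℕ} (hm : m ≤ n) :
    (M.configAt x m).inPos ≤ j :=
  (M.monotone_inPos x hm).trans h.1.le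

theorem exists_crosses {x : ℕ → Sig} {j m : ℕ} (h : (M.configAt x m).inPos = j + 1) :
    ∃ n, M.Crosses x j n := by
  induction m with
  | zero => cases h
  | succ m ih =>
    by_cases hm : (M.configAt x m).inPos = j + 1
    · exact ih hm
    · have hstep := M.inPos_step x (M.configAt x m)
      rw [← configAt_succ] at hstep
      exact ⟨m, by omega, h⟩

theorem Crosses.outputUpTo_eq {x : ℕ → Sig} {j n : ℕ} (h : M.Crosses x j n) :
    M.outputUpTo x j = (M.configAt x (n + 1)).output := by
  classical
  have hex : ∃ n, (M.configAt x n).inPos = j + 1 := ⟨n + 1, h.2⟩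
  have hfind : Nat.find hex = n + 1 := (Nat.find_eq_iff hex).2
    ⟨h.2, fun m hm heq => by have := h.inPos_le (Nat.lt_succ_iff.1 hm); omega⟩
  rw [outputUpTo, dif_pos hex]
  exact congrArg (fun n => (M.configAt x n).output) hfind

theorem outputUpTo_eq_nil {x : ℕ → Sig} {j : ℕ} (h : ¬ ∃ n, M.Crosses x j n) :
    M.outputUpTo x j = [] :=
  dif_neg fun ⟨_, hn⟩ => h (exists_crosses hn)

variable (M) in
theorem exists_outputUpTo_eq (x : ℕ → Sig) (j : ℕ) :
    ∃ n, M.outputUpTo x j = (M.configAt x n).output := by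
  by_cases h : ∃ n, M.Crosses x j n
  · exact ⟨_, h.choose_spec.outputUpTo_eq⟩
  · exact ⟨0, outputUpTo_eq_nil h⟩

variable (M) in
theorem outputUpTo_prefix_of_length_le (x : ℕ → Sig) {j j' : ℕ}
    (h : (M.outputUpTo x j).length ≤ (M.outputUpTo x j').length) :
    M.outputUpTo x j <+: M.outputUpTo x j' := by
  obtain ⟨n, hn⟩ := M.exists_outputUpTo_eq x j
  obtain ⟨n', hn'⟩ := M.exists_outputUpTo_eq x j'
  rw [hn, hn'] at h ⊢
  exact List.prefix_of_prefix_length_le (M.output_prefix_of_le x (le_max_left n n'))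
    (M.output_prefix_of_le x (le_max_right n n')) h

theorem configAt_congr {x x' : ℕ → Sig} {j : ℕ} (h : ∀ k < j, x' k = x k) {n : ℕ}
    (hn : ∀ m < n, (M.configAt x m).inPos ≤ j) : M.configAt x' n = M.configAt x n := by
  induction n with
  | zero => rfl
  | succ n ih =>
    have htape : ∀ i ≤ j, inputTape x' i = inputTape x i
      | 0, _ => rfl
      | i + 1, hi => congrArg some (h i hi)
    rw [configAt_succ, configAt_succ, ih fun m hm => hn m (by omega), step, step,
      htape _ (hn n (by omega))]

theorem Crosses.configAt_eq {x x' : ℕ → Sig} {j n : ℕ} (hn : M.Crosses x j n)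
    (h : ∀ k < j, x' k = x k) {m : ℕ} (hm : m ≤ n + 1) : M.configAt x' m = M.configAt x m :=
  configAt_congr h fun _ hl => hn.inPos_le (by omega)

theorem Crosses.congr {x x' : ℕ → Sig} {j n : ℕ} (hn : M.Crosses x j n)
    (h : ∀ k < j, x' k = x k) : M.Crosses x' j n := by
  rwa [Crosses, hn.configAt_eq h (Nat.le_succ n), hn.configAt_eq h le_rfl]

theorem outputUpTo_congr {x x' : ℕ → Sig} {j : ℕ} (h : ∀ k < j, x' k = x k) :
    M.outputUpTo x' j = M.outputUpTo x j := by
  by_cases hx : ∃ n, M.Crosses x j n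
  · obtain ⟨n, hn⟩ := hx
    rw [hn.outputUpTo_eq, (hn.congr h).outputUpTo_eq, hn.configAt_eq h le_rfl]
  · rw [outputUpTo_eq_nil hx, outputUpTo_eq_nil]
    exact fun ⟨n, hn⟩ => hx ⟨n, hn.congr fun k hk => (h k hk).symm⟩

theorem Computes.getElem?_eq {f : (ℕ → Sig) →. (ℕ → Gam)} (hM : M.Computes f) {x : ℕ → Sig}
    {y : ℕ → Gam} (hy : y ∈ f x) {i j : ℕ} (hi : i < (M.outputUpTo x j).length) :
    (M.outputUpTo x j)[i]? = some (y i) := by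
  obtain ⟨j', hj'⟩ := hM x y hy (M.outputUpTo x j).length
  have hprefix : M.outputUpTo x j <+: M.outputUpTo x j' :=
    M.outputUpTo_prefix_of_length_le x (by simpa using hj'.length_le)
  have heq : M.outputUpTo x j = wordPrefix y (M.outputUpTo x j).length :=
    (List.prefix_of_prefix_length_le hprefix hj' (by simp)).eq_of_length (by simp)
  rw [heq]
  exact getElem?_wordPrefix _ hi

end StreamMachine

theorem IsComputableFunction.continuous {Sig Gam : Type*}
    [TopologicalSpace Sig] [DiscreteTopology Sig] [TopologicalSpace Gam] [DiscreteTopology Gam]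
    {f : (ℕ → Sig) →. (ℕ → Gam)} (hf : IsComputableFunction f) : Continuous f.asSubtype := by
  obtain ⟨M, hM⟩ := hf
  refine continuous_asSubtype_iff.2 fun x y hy i => ?_
  obtain ⟨j, hj⟩ := hM x y hy (i + 1)
  have hi : i < (M.outputUpTo x j).length := by simpa using hj.length_le
  refine ⟨j, (outputLetters_eq_singleton_iff hy).2 fun x' y' hy' hx' => ?_⟩
  have hout := hM.getElem?_eq hy' (i := i) (j := j) (by rwa [StreamMachine.outputUpTo_congr hx'])
  rw [StreamMachine.outputUpTo_congr hx', hM.getElem?_eq hy hi] at hout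
  exact (Option.some_inj.1 hout).symm

/-! ### Weighted path systems -/

/-- A graph whose vertices carry a weight, a tape symbol and an output letter, together with an
acceptance condition on infinite paths that depends only on their tails. Its paths stand for
labelled tapes: the weight of a path is a position in the output, and its letter, which is constant
along the path, is the output letter at that position. -/
structure PathSystem (Sig Gam S : Type*) where
  edge : S → S → Prop
  weight : S → ℕ
  sym : S → Option Sig
  letter : S → Gam
  acc : (ℕ → S) → Prop
  acc_tail : ∀ ρ : ℕ → S, (∀ n, edge (ρ n) (ρ (n + 1))) → (acc (fun n => ρ (n + 1)) ↔ acc ρ)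
  edge_sym : ∀ s s', edge s s' → sym s' ≠ none
  edge_letter : ∀ s s', edge s s' → letter s' = letter s

namespace PathSystem

variable {Sig Gam S : Type*} (N : PathSystem Sig Gam S)

/-- The weights along `ρ` add up to `i`; in particular only finitely many of them are nonzero. -/
def HasTotal (ρ : ℕ → S) (i : ℕ) : Prop :=
  ∀ᶠ n in atTop, ∑ k ∈ Finset.range n, N.weight (ρ k) = i

/-- `ρ` is an accepting path of total weight `i`. -/
structure IsAccepting (ρ : ℕ → S) (i : ℕ) : Prop where
  edge : ∀ n, N.edge (ρ n) (ρ (n + 1))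
  acc : N.acc ρ
  total : N.HasTotal ρ i

/-- `N` describes `f` if `f x` has the letter `c` at position `i` exactly when there is an accepting
path of total weight `i` and letter `c` over the tape of `x`. -/
def Describes (f : (ℕ → Sig) →. (ℕ → Gam)) : Prop :=
  ∀ x i c, (∃ y ∈ f x, y i = c) ↔
    ∃ ρ, N.IsAccepting ρ i ∧ (∀ n, N.sym (ρ n) = inputTape x n) ∧ N.letter (ρ 0) = c

/-- Transport of a path system along an equivalence of the vertex types. -/
def map {S' : Type*} (e : S ≃ S') : PathSystem Sig Gam S' where
  edge s s' := N.edge (e.symm s) (e.symm s')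
  weight s := N.weight (e.symm s)
  sym s := N.sym (e.symm s)
  letter s := N.letter (e.symm s)
  acc ρ := N.acc (fun n => e.symm (ρ n))
  acc_tail ρ h := N.acc_tail (fun n => e.symm (ρ n)) h
  edge_sym _ _ h := N.edge_sym _ _ h
  edge_letter _ _ h := N.edge_letter _ _ h

/-- Some accepting path from `s` has total weight `i`. -/
def Total (s : S) (i : ℕ) : Prop :=
  ∃ ρ, ρ 0 = s ∧ N.IsAccepting ρ i

variable {N}

theorem Describes.map {f : (ℕ → Sig) →. (ℕ → Gam)} (h : N.Describes f) {S' : Type*} (e : S ≃ S') :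
    (N.map e).Describes f := by
  intro x i c
  rw [h x i c]
  constructor
  · rintro ⟨ρ, ⟨hedge, hacc, htotal⟩, hsym, hletter⟩
    have hid : (fun n => e.symm (e (ρ n))) = ρ := by simp
    exact ⟨fun n => e (ρ n), ⟨by simpa [PathSystem.map] using hedge,
      by simpa only [PathSystem.map, hid] using hacc,
      by simpa only [PathSystem.map, HasTotal, Equiv.symm_apply_apply] using htotal⟩,
      by simpa [PathSystem.map] using hsym, by simpa [PathSystem.map] using hletter⟩
  · rintro ⟨ρ, ⟨hedge, hacc, htotal⟩, hsym, hletter⟩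
    exact ⟨fun n => e.symm (ρ n), ⟨hedge, hacc, htotal⟩, hsym, hletter⟩

theorem hasTotal_tail_iff {ρ : ℕ → S} {i : ℕ} :
    N.HasTotal (fun n => ρ (n + 1)) i ↔ N.HasTotal ρ (N.weight (ρ 0) + i) := by
  unfold HasTotal
  nth_rw 2 [← map_add_atTop_eq_nat 1]
  simp only [eventually_map, Finset.sum_range_succ', add_comm _ (N.weight (ρ 0)),
    Nat.add_left_cancel_iff]

theorem HasTotal.weight_le {ρ : ℕ → S} {i : ℕ} (h : N.HasTotal ρ i) : N.weight (ρ 0) ≤ i := by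
  obtain ⟨n, hn, hpos⟩ := (h.and (eventually_gt_atTop 0)).exists
  exact (Finset.single_le_sum_of_canonicallyOrdered (f := fun k => N.weight (ρ k))
    (Finset.mem_range.2 hpos)).trans hn.le

theorem IsAccepting.exists_tail {ρ : ℕ → S} {i : ℕ} (h : N.IsAccepting ρ i) :
    ∃ d, N.IsAccepting (fun n => ρ (n + 1)) d ∧ N.weight (ρ 0) + d = i := by
  obtain ⟨d, rfl⟩ := Nat.exists_eq_add_of_le h.total.weight_le
  exact ⟨d, ⟨fun n => h.edge (n + 1), (N.acc_tail ρ h.edge).2 h.acc, hasTotal_tail_iff.2 h.total⟩,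
    rfl⟩

theorem IsAccepting.cons {s : S} {ρ : ℕ → S} {i : ℕ} (h : N.IsAccepting ρ i)
    (he : N.edge s (ρ 0)) : N.IsAccepting (consWord s ρ) (N.weight s + i) := by
  have hedge : ∀ n, N.edge (consWord s ρ n) (consWord s ρ (n + 1)) := by
    rintro (_ | n)
    exacts [he, h.edge n]
  exact ⟨hedge, (N.acc_tail _ hedge).1 h.acc, hasTotal_tail_iff.1 h.total⟩

theorem Total.cons {s s' : S} {i : ℕ} (h : N.Total s' i) (he : N.edge s s') :
    N.Total s (N.weight s + i) := by
  obtain ⟨ρ, rfl, h⟩ := h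
  exact ⟨consWord s ρ, rfl, h.cons he⟩

/-! ### The possible totals -/

variable (N) in
/-- An edge that leaves a vertex of weight `0`. -/
def SilentEdge (s t : S) : Prop :=
  N.edge s t ∧ N.weight s = 0

theorem IsAccepting.exists_silent_path {ρ : ℕ → S} {i : ℕ} (h : N.IsAccepting ρ i) (hi : 0 < i) :
    ∃ t t' d, Relation.ReflTransGen N.SilentEdge (ρ 0) t ∧ N.edge t t' ∧ 0 < N.weight t ∧
      N.Total t' d ∧ N.weight t + d = i := by
  obtain ⟨m, hm⟩ := h.total.exists
  induction m generalizing ρ i with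
  | zero => simp at hm; omega
  | succ m ih =>
    obtain ⟨d, hd, rfl⟩ := h.exists_tail
    rcases Nat.eq_zero_or_pos (N.weight (ρ 0)) with hw | hw
    · rw [hw, zero_add] at hi hm ⊢
      rw [Finset.sum_range_succ', hw, add_zero] at hm
      obtain ⟨t, t', d', hpath, ht⟩ := ih hd hi hm
      exact ⟨t, t', d', .head ⟨h.edge 0, hw⟩ hpath, ht⟩
    · exact ⟨ρ 0, ρ 1, d, .refl, h.edge 0, hw, ⟨_, rfl, hd⟩, rfl⟩

theorem total_iff_of_pos {s : S} {i : ℕ} (hi : 0 < i) :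
    N.Total s i ↔ ∃ t t' d, Relation.ReflTransGen N.SilentEdge s t ∧ N.edge t t' ∧
      0 < N.weight t ∧ N.Total t' d ∧ N.weight t + d = i := by
  constructor
  · rintro ⟨ρ, rfl, h⟩
    exact h.exists_silent_path hi
  · rintro ⟨t, t', d, hpath, hedge, -, htotal, rfl⟩
    induction hpath using Relation.ReflTransGen.head_induction_on with
    | refl => exact htotal.cons hedge
    | head h _ ih => simpa [h.2] using ih.cons h.1

variable (N)

/-- The largest weight of a vertex. -/
noncomputable def maxWeight : ℕ :=
  ⨆ s, N.weight s

theorem weight_le_maxWeight [Finite S] (s : S) : N.weight s ≤ N.maxWeight :=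
  le_ciSup (Set.finite_range N.weight).bddAbove s

/-- A deterministic automaton that reads a number `n` in unary and then knows the set of all
vertices with an accepting path of total weight `n`. -/
structure WeightAutomaton (X : Type*) where
  start : X
  next : X → X
  label : X → Set S
  mem_label_iff : ∀ n s, s ∈ label (next^[n] start) ↔ N.Total s n

/-- The vertices with an accepting path of total weight `n - k`, for all small `k`. -/
def window (n : ℕ) (k : Fin (N.maxWeight + 1)) : Set S :=
  {s | ∃ d, N.Total s d ∧ d + k = n}

/-- The computation of `window (n + 1)` from `window n`. -/
def nextWindow (x : Fin (N.maxWeight + 1) → Set S) (k : Fin (N.maxWeight + 1)) : Set S :=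
  {s | (k.1 = 0 ∧ ∃ t, ∃ t', ∃ l : Fin (N.maxWeight + 1),
      Relation.ReflTransGen N.SilentEdge s t ∧ N.edge t t' ∧ N.weight t = l.1 + 1 ∧ t' ∈ x l) ∨
    ∃ l : Fin (N.maxWeight + 1), k.1 = l.1 + 1 ∧ s ∈ x l}

theorem nextWindow_window [Finite S] (n : ℕ) : N.nextWindow (N.window n) = N.window (n + 1) := by
  ext k s
  constructor
  · rintro (⟨hk, t, t', l, hpath, hedge, hw, d, htotal, hd⟩ | ⟨l, hk, d, htotal, hd⟩)
    · exact ⟨n + 1, (total_iff_of_pos (Nat.succ_pos n)).2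
        ⟨t, t', d, hpath, hedge, by omega, htotal, by omega⟩, by omega⟩
    · exact ⟨d, htotal, by omega⟩
  · rintro ⟨d, htotal, hd⟩
    by_cases hk : k.1 = 0
    · obtain rfl : d = n + 1 := by omega
      obtain ⟨t, t', d, hpath, hedge, hw, htotal', hd'⟩ :=
        (total_iff_of_pos (Nat.succ_pos n)).1 htotal
      have := N.weight_le_maxWeight t
      exact Or.inl ⟨hk, t, t', ⟨N.weight t - 1, by omega⟩, hpath, hedge, by simp; omega, d, htotal',
        by simp; omega⟩
    · exact Or.inr ⟨⟨k - 1, by omega⟩, by simp; omega, d, htotal, by simp; omega⟩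

/-- The weight automaton whose state after reading `n` is `window n`. -/
def windowAutomaton [Finite S] : N.WeightAutomaton (Fin (N.maxWeight + 1) → Set S) where
  start := N.window 0
  next := N.nextWindow
  label x := x 0
  mem_label_iff n s := by
    have hiter : N.nextWindow^[n] (N.window 0) = N.window n := by
      induction n with
      | zero => rfl
      | succ n ih => rw [Function.iterate_succ_apply', ih, nextWindow_window]
    simp [hiter, window]

variable {N} in
/-- Transport of a weight automaton along an equivalence of the state types. -/
def WeightAutomaton.map {X Y : Type*} (B : N.WeightAutomaton X) (e : X ≃ Y) :
    N.WeightAutomaton Y where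
  start := e B.start
  next y := e (B.next (e.symm y))
  label y := B.label (e.symm y)
  mem_label_iff n s := by
    have hsemiconj : Function.Semiconj e B.next fun y => e (B.next (e.symm y)) := fun x => by simp
    simp only [← (hsemiconj.iterate_right n).eq, Equiv.symm_apply_apply, B.mem_label_iff]

theorem exists_weightAutomaton_fin [Finite S] : ∃ k, Nonempty (N.WeightAutomaton (Fin k)) :=
  ⟨_, ⟨N.windowAutomaton.map (Finite.equivFin _)⟩⟩

/-! ### Vertices reached by a finite word -/

/-- One step of the breadth-first search for the vertices that a finite tape reaches: `Z j` holds
the vertices reached with weight `j` collected strictly before them, and `a` is the symbol of the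
next cell. The left delimiter `none` starts new paths. -/
def layerStep (a : Option Sig) (Z : ℕ → Set S) (j : ℕ) : Set S :=
  {s' | N.sym s' = a ∧
    ((a = none ∧ j = 0) ∨ ∃ s j', s ∈ Z j' ∧ N.edge s s' ∧ j' + N.weight s = j)}

/-- The vertices that are reached by paths over the tape content `⊢ u` with weight `j` collected
strictly before them. -/
def reach (u : List Sig) : ℕ → Set S :=
  u.foldl (fun Z a => N.layerStep (some a) Z) (N.layerStep none fun _ => ∅)

/-- The vertices reached by `u` that have an accepting path completing the weight to `i`. -/
def candidates (u : List Sig) (i : ℕ) : Set S :=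
  {s | ∃ j d, s ∈ N.reach u j ∧ N.Total s d ∧ j + d = i}

variable {N}

theorem mem_reach_nil {s : S} {j : ℕ} : s ∈ N.reach [] j ↔ N.sym s = none ∧ j = 0 := by
  simp [reach, layerStep]

theorem reach_append_singleton (u : List Sig) (a : Sig) :
    N.reach (u ++ [a]) = N.layerStep (some a) (N.reach u) := by
  simp [reach]

theorem mem_reach_append_singleton {u : List Sig} {a : Sig} {s' : S} {j : ℕ} :
    s' ∈ N.reach (u ++ [a]) j ↔
      N.sym s' = some a ∧ ∃ s j', s ∈ N.reach u j' ∧ N.edge s s' ∧ j' + N.weight s = j := by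
  simp [reach_append_singleton, layerStep]

theorem exists_isAccepting_of_mem_reach {u : List Sig} {ρ : ℕ → S} {j d : ℕ}
    (hj : ρ 0 ∈ N.reach u j) (hρ : N.IsAccepting ρ d) :
    ∃ ρ', N.IsAccepting ρ' (j + d) ∧ N.sym (ρ' 0) = none ∧
      (∀ k < u.length, N.sym (ρ' (k + 1)) = u[k]?) ∧ ∀ n, ρ' (u.length + n) = ρ n := by
  induction u using List.reverseRecOn generalizing ρ j d with
  | nil =>
    obtain ⟨hsym, rfl⟩ := mem_reach_nil.1 hj
    exact ⟨ρ, by simpa using hρ, hsym, by simp, by simp⟩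
  | append_singleton u a ih =>
    obtain ⟨hsym, s, j', hs, hedge, rfl⟩ := mem_reach_append_singleton.1 hj
    obtain ⟨ρ', hacc, hstart, hword, htail⟩ := ih (ρ := consWord s ρ) hs (hρ.cons hedge)
    refine ⟨ρ', by rwa [add_assoc], hstart, fun k hk => ?_, fun n => ?_⟩
    · rw [List.length_append, List.length_singleton, Nat.lt_succ_iff_lt_or_eq] at hk
      rcases hk with hk | rfl
      · rw [hword k hk, List.getElem?_append_left hk]
      · rw [htail 1]
        simpa [consWord] using hsym
    · rw [List.length_append, List.length_singleton, add_assoc, add_comm 1 n, htail (n + 1)]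
      rfl

theorem letter_eq_letter_zero {ρ : ℕ → S} (h : ∀ n, N.edge (ρ n) (ρ (n + 1))) (n : ℕ) :
    N.letter (ρ n) = N.letter (ρ 0) := by
  induction n with
  | zero => rfl
  | succ n ih => rw [N.edge_letter _ _ (h n), ih]

theorem IsAccepting.exists_mem_reach {x : ℕ → Sig} {ρ : ℕ → S} {i : ℕ} (h : N.IsAccepting ρ i)
    (hsym : ∀ n, N.sym (ρ n) = inputTape x n) (k : ℕ) :
    ∃ j d, ρ k ∈ N.reach (wordPrefix x k) j ∧ N.IsAccepting (fun n => ρ (k + n)) d ∧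
      j + d = i := by
  induction k with
  | zero => exact ⟨0, i, mem_reach_nil.2 ⟨hsym 0, rfl⟩, by simpa using h, zero_add i⟩
  | succ k ih =>
    obtain ⟨j, d, hj, hd, rfl⟩ := ih
    obtain ⟨d', hd', rfl⟩ := hd.exists_tail
    refine ⟨j + N.weight (ρ k), d', ?_, ?_, add_assoc _ _ _⟩
    · rw [wordPrefix_succ, mem_reach_append_singleton]
      exact ⟨hsym (k + 1), ρ k, j, hj, h.edge k, rfl⟩
    · simpa only [add_assoc, add_comm 1] using hd'

theorem IsAccepting.exists_sym_eq_inputTape {ρ : ℕ → S} {i : ℕ} (h : N.IsAccepting ρ i)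
    (h0 : N.sym (ρ 0) = none) : ∃ x : ℕ → Sig, ∀ n, N.sym (ρ n) = inputTape x n := by
  choose x hx using fun n => Option.ne_none_iff_exists'.1 (N.edge_sym _ _ (h.edge n))
  refine ⟨x, ?_⟩
  rintro (_ | n)
  exacts [h0, hx n]

theorem Describes.outputLetters_eq {f : (ℕ → Sig) →. (ℕ → Gam)} (hf : N.Describes f)
    (u : List Sig) (i : ℕ) : outputLetters f u i = N.letter '' N.candidates u i := by
  ext c
  constructor
  · rintro ⟨x, y, hy, hu, rfl⟩
    obtain ⟨ρ, hρ, hsym, hletter⟩ := (hf x i (y i)).1 ⟨y, hy, rfl⟩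
    obtain ⟨j, d, hj, hd, hi⟩ := hρ.exists_mem_reach hsym u.length
    rw [← hu] at hj
    exact ⟨_, ⟨j, d, hj, ⟨_, rfl, hd⟩, hi⟩, by rw [letter_eq_letter_zero hρ.edge, hletter]⟩
  · rintro ⟨_, ⟨j, d, hj, ⟨ρ, rfl, hρ⟩, rfl⟩, rfl⟩
    obtain ⟨ρ', hacc, hstart, hword, htail⟩ := exists_isAccepting_of_mem_reach hj hρ
    obtain ⟨x, hx⟩ := hacc.exists_sym_eq_inputTape hstart
    obtain ⟨y, hy, hletter⟩ := (hf x (j + d) (N.letter (ρ' 0))).2 ⟨ρ', hacc, hx, rfl⟩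
    refine ⟨x, y, hy, List.ext_getElem? fun k => ?_, ?_⟩
    · by_cases hk : k < u.length
      · rw [← hword k hk, hx, getElem?_wordPrefix x hk, inputTape]
      · simp [not_lt.1 hk]
    · rw [hletter, ← htail 0]
      exact (letter_eq_letter_zero hacc.edge _).symm

/-! ### The mismatch problem -/

section Mismatch

variable {K n : ℕ} (N : PathSystem Sig Gam (Fin K)) (e : Fin n ≃ Sig)

open Classical in
/-- The vertices reached by a finite word and the weights collected before them, as a list. -/
noncomputable def reachList (u : List (Fin n)) : List (Fin K × ℕ) :=
  u.foldl (fun l a => l.flatMap fun z =>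
      ((List.finRange K).filter fun s => N.edge z.1 s ∧ N.sym s = some (e a)).map
        fun s => (s, z.2 + N.weight z.1))
    (((List.finRange K).filter fun s => N.sym s = none).map fun s => (s, 0))

theorem mem_reachList {u : List (Fin n)} {s : Fin K} {j : ℕ} :
    (s, j) ∈ N.reachList e u ↔ s ∈ N.reach (u.map e) j := by
  induction u using List.reverseRecOn generalizing s j with
  | nil => simp [mem_reach_nil, reachList, eq_comm]
  | append_singleton u a ih =>
    rw [List.map_append, List.map_singleton, mem_reach_append_singleton, reachList,
      List.foldl_append]
    change (s, j) ∈ (N.reachList e u).flatMap _ ↔ _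
    simp only [List.mem_flatMap, Prod.exists, ih, List.mem_map, List.mem_filter,
      List.mem_finRange, true_and, decide_eq_true_eq, Prod.mk.injEq]
    constructor
    · rintro ⟨t, i, ht, _, ⟨hedge, hsym⟩, rfl, rfl⟩
      exact ⟨hsym, t, i, ht, hedge, rfl⟩
    · rintro ⟨hsym, t, i, ht, hedge, rfl⟩
      exact ⟨t, i, ht, s, ⟨hedge, hsym⟩, rfl, rfl⟩

theorem primrec_reachList : Primrec (N.reachList e) := by
  classical
  refine Primrec.list_foldl
    (h := fun _ (p : List (Fin K × ℕ) × Fin n) => p.1.flatMap fun z =>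
      ((List.finRange K).filter fun s => N.edge z.1 s ∧ N.sym s = some (e p.2)).map
        fun s => (s, z.2 + N.weight z.1))
    Primrec.id (Primrec.const _) ?_
  refine Primrec.list_flatMap (Primrec.fst.comp Primrec.snd) (Primrec.list_map ?_ ?_)
  · exact (Primrec.dom_finite fun q : Fin K × Fin n =>
      (List.finRange K).filter fun s => N.edge q.1 s ∧ N.sym s = some (e q.2)).comp
        (Primrec.pair (Primrec.fst.comp Primrec.snd)
          (Primrec.snd.comp (Primrec.snd.comp Primrec.fst)))
  · exact Primrec.pair Primrec.snd (Primrec.nat_add.comp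
      (Primrec.snd.comp (Primrec.snd.comp Primrec.fst))
      ((Primrec.dom_finite N.weight).comp (Primrec.fst.comp (Primrec.snd.comp Primrec.fst))))

theorem primrecRel_total : PrimrecRel N.Total := by
  classical
  obtain ⟨k, ⟨B⟩⟩ := N.exists_weightAutomaton_fin
  have hlabel : PrimrecPred fun q : Fin K × Fin k => q.1 ∈ B.label q.2 :=
    ⟨inferInstance, Primrec.dom_finite _⟩
  have hiterate : Primrec fun i : ℕ => B.next^[i] B.start :=
    Primrec.nat_iterate Primrec.id (Primrec.const _) ((Primrec.dom_finite B.next).comp Primrec.snd)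
  exact (hlabel.comp (Primrec.pair Primrec.fst (hiterate.comp Primrec.snd))).of_eq
    fun p => B.mem_label_iff p.2 p.1

theorem primrecRel_mem_candidates :
    PrimrecRel fun (s : Fin K) (p : List (Fin n) × ℕ) => s ∈ N.candidates (p.1.map e) p.2 := by
  have hcompletes : PrimrecRel fun (z : Fin K × ℕ) (q : Fin K × ℕ) =>
      z.1 = q.1 ∧ z.2 ≤ q.2 ∧ N.Total z.1 (q.2 - z.2) := by
    refine .and ?_ (.and ?_ ?_)
    · exact Primrec.eq.comp (Primrec.fst.comp Primrec.fst) (Primrec.fst.comp Primrec.snd)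
    · exact Primrec.nat_le.comp (Primrec.snd.comp Primrec.fst) (Primrec.snd.comp Primrec.snd)
    · exact N.primrecRel_total.comp (Primrec.fst.comp Primrec.fst)
        (Primrec.nat_sub.comp (Primrec.snd.comp Primrec.snd) (Primrec.snd.comp Primrec.fst))
  refine (hcompletes.exists_mem_list.comp
    (f := fun q : Fin K × List (Fin n) × ℕ => N.reachList e q.2.1) (g := fun q => (q.1, q.2.2))
    ((N.primrec_reachList e).comp (Primrec.fst.comp Primrec.snd))
    (Primrec.pair Primrec.fst (Primrec.snd.comp Primrec.snd))).of_eq ?_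
  rintro ⟨s, u, i⟩
  constructor
  · rintro ⟨⟨_, j⟩, hj, rfl, hle, htotal⟩
    exact ⟨j, i - j, (N.mem_reachList e).1 hj, htotal, Nat.add_sub_cancel' hle⟩
  · rintro ⟨j, d, hj, htotal, rfl⟩
    exact ⟨(s, j), (N.mem_reachList e).2 hj, rfl, Nat.le_add_right j d, by simpa using htotal⟩

variable {N} in
theorem Describes.mismatchDecidable {f : (ℕ → Sig) →. (ℕ → Gam)} (hf : N.Describes f) :
    MismatchDecidable f := by
  classical
  intro n m e e'
  have hrefutes : PrimrecRel fun (s : Fin K) (p : (List (Fin n) × List (Fin m)) × ℕ) =>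
      s ∈ N.candidates (p.1.1.map e) p.2 ∧ ¬ p.1.2[p.2]? = some (e'.symm (N.letter s)) := by
    refine .and ?_ (.not ?_)
    · exact (N.primrecRel_mem_candidates e).comp Primrec.fst
        (Primrec.pair (Primrec.fst.comp (Primrec.fst.comp Primrec.snd))
          (Primrec.snd.comp Primrec.snd))
    · exact Primrec.eq.comp
        (Primrec.list_getElem?.comp (Primrec.snd.comp (Primrec.fst.comp Primrec.snd))
          (Primrec.snd.comp Primrec.snd))
        ((Primrec.dom_finite fun s => some (e'.symm (N.letter s))).comp Primrec.fst)
  have hposition : PrimrecRel fun (i : ℕ) (p : List (Fin n) × List (Fin m)) =>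
      ∃ s ∈ List.finRange K,
        s ∈ N.candidates (p.1.map e) i ∧ ¬ p.2[i]? = some (e'.symm (N.letter s)) :=
    hrefutes.exists_mem_list.comp (Primrec.const _) (Primrec.pair Primrec.snd Primrec.fst)
  obtain ⟨hdec, hprim⟩ := (hposition.exists_mem_list.comp
    (f := fun p : List (Fin n) × List (Fin m) => List.range p.2.length) (g := id)
    (Primrec.list_range.comp (Primrec.list_length.comp Primrec.snd)) Primrec.id).of_eq
      (q := fun p => HasMismatch f (p.1.map e) (p.2.map e')) fun p => by
    simp only [hasMismatch_iff, hf.outputLetters_eq, List.mem_range, List.mem_finRange, true_and,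
      List.length_map, List.getElem?_map, Set.exists_mem_image, id, ne_eq]
    refine exists_congr fun i => and_congr_right fun _ => exists_congr fun s =>
      and_congr_right fun _ => not_congr ?_
    cases p.2[i]? <;> simp [Equiv.eq_symm_apply]
  exact ⟨hdec, hprim.to_comp⟩

end Mismatch

end PathSystem

/-! ### The predicting machine -/

namespace StreamMachine

variable {Sig Gam : Type*} {M : StreamMachine Sig Gam} {x : ℕ → Sig}

/-- Reachability between configurations on input `x`. -/
abbrev Reaches (M : StreamMachine Sig Gam) (x : ℕ → Sig) : M.Config → M.Config → Prop :=
  Relation.ReflTransGen fun c c' => M.step x c = c'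

theorem exists_configAt_eq {t : ℕ} {c : M.Config} (h : M.Reaches x (M.configAt x t) c) :
    ∃ t', M.configAt x t' = c := by
  induction h with
  | refl => exact ⟨t, rfl⟩
  | tail _ hstep ih =>
    obtain ⟨t', rfl⟩ := ih
    exact ⟨t' + 1, (M.configAt_succ x t').trans hstep⟩

end StreamMachine

namespace PathSystem

section Pending

variable {Sig Gam S : Type*} (N : PathSystem Sig Gam S) (a : Option Sig) (Z : ℕ → Set S)

/-- The contributions of the cells `j' < l` to `layerStep a Z (j + d)`, for all small `d`. A machine
that computes `layerStep a Z` cell by cell carries them along, since a vertex in cell `j'` may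
contribute to any of the cells `j', …, j' + maxWeight`. -/
def pending (l j : ℕ) : Set (Fin (N.maxWeight + 1) × S) :=
  {p | N.sym p.2 = a ∧ ((a = none ∧ j + p.1 = 0) ∨
    ∃ s j', j' < l ∧ s ∈ Z j' ∧ N.edge s p.2 ∧ j' + N.weight s = j + p.1)}

/-- The contribution of a cell with content `z` to itself and the following ones. -/
def contribution (z : Set S) : Set (Fin (N.maxWeight + 1) × S) :=
  {p | N.sym p.2 = a ∧ ∃ s ∈ z, N.edge s p.2 ∧ N.weight s = p.1}

/-- Pending contributions relative to the next cell. -/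
def shift (m : Set (Fin (N.maxWeight + 1) × S)) : Set (Fin (N.maxWeight + 1) × S) :=
  {p | ∃ k : Fin (N.maxWeight + 1), k.1 = p.1 + 1 ∧ (k, p.2) ∈ m}

theorem pending_zero_congr (Z' : ℕ → Set S) (j : ℕ) :
    N.pending a Z 0 j = N.pending a Z' 0 j := by
  simp [pending]

theorem pending_union_contribution (j : ℕ) :
    N.pending a Z j j ∪ N.contribution a (Z j) = N.pending a Z (j + 1) j := by
  ext p
  constructor
  · rintro (⟨hsym, h | ⟨s, j', hj', h⟩⟩ | ⟨hsym, s, hs, hedge, hw⟩)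
    · exact ⟨hsym, Or.inl h⟩
    · exact ⟨hsym, Or.inr ⟨s, j', by omega, h⟩⟩
    · exact ⟨hsym, Or.inr ⟨s, j, by omega, hs, hedge, by omega⟩⟩
  · rintro ⟨hsym, h | ⟨s, j', hj', hs, hedge, hw⟩⟩
    · exact Or.inl ⟨hsym, Or.inl h⟩
    · rcases Nat.lt_succ_iff_lt_or_eq.1 hj' with hj' | rfl
      · exact Or.inl ⟨hsym, Or.inr ⟨s, j', hj', hs, hedge, hw⟩⟩
      · exact Or.inr ⟨hsym, s, hs, hedge, by omega⟩

theorem setOf_zero_mem_pending (j : ℕ) :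
    {s | (0, s) ∈ N.pending a Z (j + 1) j} = N.layerStep a Z j := by
  ext s'
  refine and_congr_right fun _ => or_congr Iff.rfl (exists_congr fun s => exists_congr fun j' => ?_)
  simp only [Fin.val_zero, add_zero, and_iff_right_iff_imp]
  omega

variable [Finite S]

theorem shift_pending (j : ℕ) :
    N.shift (N.pending a Z (j + 1) j) = N.pending a Z (j + 1) (j + 1) := by
  ext p
  constructor
  · rintro ⟨k, hk, hsym, ⟨-, h⟩ | ⟨s, j', hj', hs, hedge, hw⟩⟩
    · dsimp only at h
      omega
    · exact ⟨hsym, Or.inr ⟨s, j', hj', hs, hedge, by dsimp only at hw; omega⟩⟩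
  · rintro ⟨hsym, ⟨-, h⟩ | ⟨s, j', hj', hs, hedge, hw⟩⟩
    · omega
    · have := N.weight_le_maxWeight s
      exact ⟨⟨p.1 + 1, by omega⟩, rfl, hsym,
        Or.inr ⟨s, j', hj', hs, hedge, by dsimp only; omega⟩⟩

variable {Z} {n : ℕ}

theorem pending_eq_empty (hZ : ∀ j, n ≤ j → Z j = ∅) {j : ℕ} (hj : n + N.maxWeight < j) :
    N.pending a Z j j = ∅ := by
  refine Set.eq_empty_of_forall_notMem ?_
  rintro p ⟨-, ⟨-, h⟩ | ⟨s, j', -, hs, -, hw⟩⟩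
  · omega
  · have := N.weight_le_maxWeight s
    rw [hZ j' (by omega)] at hs
    exact hs

theorem layerStep_eq_empty (hZ : ∀ j, n ≤ j → Z j = ∅) {l : ℕ} (hl : n ≤ l)
    (hpending : N.pending a Z l l = ∅) {j : ℕ} (hj : l ≤ j) : N.layerStep a Z j = ∅ := by
  refine Set.eq_empty_of_forall_notMem ?_
  rintro s' ⟨hsym, ⟨ha, rfl⟩ | ⟨s, j', hs, hedge, hw⟩⟩
  · exact Set.eq_empty_iff_forall_notMem.1 hpending (0, s') ⟨hsym, Or.inl ⟨ha, by simpa using hj⟩⟩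
  · have hj' : j' < n := by
      by_contra hle
      rw [hZ j' (by omega)] at hs
      exact hs
    have := N.weight_le_maxWeight s
    exact Set.eq_empty_iff_forall_notMem.1 hpending (⟨j - l, by omega⟩, s')
      ⟨hsym, Or.inr ⟨s, j', by omega, hs, hedge, by dsimp only; omega⟩⟩

end Pending

/-- The control states of the predicting machine. Each input symbol is processed in a sweep to the
right (`up`), which updates the table of reached vertices and, if `adv` holds, marks one more cell,
and a sweep to the left, which looks for the last marked cell (`back`) and from there on collects
the vertices that determine the possible next letters (`scan`). -/
inductive PredictorMode {Sig Gam S : Type*} (N : PathSystem Sig Gam S) (X : Type*)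
  | start (adv : Bool)
  | up (adv : Bool) (m : Set (Fin (N.maxWeight + 1) × S))
  | back
  | scan (x : X) (C : Set S)

instance {Sig Gam S X : Type*} (N : PathSystem Sig Gam S) [Finite S] [Finite X] :
    Finite (N.PredictorMode X) := by
  refine Finite.of_surjective (α := Bool ⊕ (Bool × Set (Fin (N.maxWeight + 1) × S)) ⊕ Unit ⊕
    (X × Set S)) (Sum.elim .start (Sum.elim (fun p => .up p.1 p.2) (Sum.elim (fun _ => .back)
      fun p => .scan p.1 p.2))) ?_
  rintro (adv | ⟨adv, m⟩ | _ | ⟨x, C⟩)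
  exacts [⟨.inl adv, rfl⟩, ⟨.inr (.inl (adv, m)), rfl⟩, ⟨.inr (.inr (.inl ())), rfl⟩,
    ⟨.inr (.inr (.inr (x, C))), rfl⟩]

namespace WeightAutomaton

variable {Sig Gam : Type*} {S X : Type} {N : PathSystem Sig Gam S} (B : N.WeightAutomaton X)

/-- The work tape that holds `Z` on its first `n` cells and marks on its first `l` cells. -/
def table (n : ℕ) (Z : ℕ → Set S) (l j : ℕ) : Option (Set S) × Bool :=
  (if j < n then some (Z j) else none, decide (j < l))

theorem table_fst_getD {n : ℕ} {Z : ℕ → Set S} (hZ : ∀ j, n ≤ j → Z j = ∅) (l j : ℕ) :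
    (table n Z l j).1.getD ∅ = Z j := by
  by_cases h : j < n
  · simp [table, h]
  · simp [table, h, hZ j (not_lt.1 h)]

/-- The contents `cells` on the first `j` cells and `cells'` on the others. -/
def splice (j : ℕ) (cells cells' : ℕ → Option (Set S) × Bool) (i : ℕ) : Option (Set S) × Bool :=
  if i < j then cells i else cells' i

theorem splice_zero (cells cells' : ℕ → Option (Set S) × Bool) : splice 0 cells cells' = cells' :=
  funext fun _ => if_neg (Nat.not_lt_zero _)

theorem update_splice (j : ℕ) (cells cells' : ℕ → Option (Set S) × Bool) :
    Function.update (splice j cells cells') j (cells j) = splice (j + 1) cells cells' := by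
  ext1 i
  rcases lt_trichotomy i j with h | rfl | h
  · simp [splice, h, h.ne, Nat.lt_succ_of_lt h]
  · simp [splice]
  · simp [splice, h.ne', h.not_gt, show ¬ i < j + 1 by omega]

open Classical in
/-- The transitions of the predicting machine. Cell `j` of its work tape holds the vertices reached
with weight `j`, or `none` beyond the end of the table, and a mark if `j` is at most the length of
the output; `adv` says that the mark of the last cell is still missing. During the sweep to the left
the weight automaton reads one letter per cell, so that the weights collected and the totals of the
scanned vertices add up to the length of the output. -/
noncomputable def predictorTrans : N.PredictorMode X → Option Sig → Option (Option (Set S) × Bool) →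
    Option (MachineAction (N.PredictorMode X) (Option (Set S) × Bool) Gam)
  | .start adv, a, none =>
    some ⟨.up adv (N.pending a (fun _ => ∅) 0 0), (none, false), .right, false, none⟩
  | .up adv m, a, some (z, b) =>
    if z = none ∧ m = ∅ ∧ (b || adv) = false then some ⟨.back, (z, b), .left, false, none⟩
    else
      let m' := m ∪ N.contribution a (z.getD ∅)
      some ⟨.up (adv && b) (N.shift m'), (some {s | (0, s) ∈ m'}, b || adv), .right, false, none⟩
  | .back, _, some (z, false) => some ⟨.back, (z, false), .left, false, none⟩
  | .back, _, some (z, true) => some ⟨.scan B.start ∅, (z, true), .stay, false, none⟩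
  | .scan x C, _, some (z, b) =>
    some ⟨.scan (B.next x) (C ∪ z.getD ∅ ∩ B.label x), (z, b), .left, false, none⟩
  | .scan _ C, _, none =>
    some ⟨.start (onlyElement (N.letter '' C)).isSome, (none, false), .stay, true,
      onlyElement (N.letter '' C)⟩
  | _, _, _ => none

variable [Finite S] [Finite X]

/-- A machine that outputs the next letter as soon as it is determined by the input read so far. -/
noncomputable def predictor : StreamMachine Sig Gam where
  State := N.PredictorMode X
  Work := Option (Set S) × Bool
  finState := inferInstance
  finWork := inferInstance
  blank := (none, false)
  init := .start true
  trans := B.predictorTrans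

/-- Configurations of the predicting machine, with its type of states unfolded. -/
noncomputable def config (q : N.PredictorMode X) (k : ℕ) (cells : ℕ → Option (Set S) × Bool)
    (p : ℕ) (v : List Gam) : B.predictor.Config :=
  ⟨q, k, cells, p, v⟩

variable {w : ℕ → Sig} {k : ℕ} {cells : ℕ → Option (Set S) × Bool} {j : ℕ} {v : List Gam}

theorem step_start (adv : Bool) : B.predictor.step w (B.config (.start adv) k cells 0 v) =
    B.config (.up adv (N.pending (inputTape w k) (fun _ => ∅) 0 0)) k cells 1 v := by
  simp [StreamMachine.step, predictor, config, predictorTrans, StreamMachine.readWork,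
    StreamMachine.writeWork, StreamMachine.movedPos]

theorem step_up_halt (h : cells j = (none, false)) :
    B.predictor.step w (B.config (.up false ∅) k cells (j + 1) v) = B.config .back k cells j v := by
  simp [StreamMachine.step, predictor, config, predictorTrans, StreamMachine.readWork,
    StreamMachine.writeWork, StreamMachine.movedPos, h, Function.update_eq_self_iff]

theorem step_up {adv : Bool} {m m' : Set (Fin (N.maxWeight + 1) × S)} {z : Option (Set S)}
    {b : Bool} (hcell : cells j = (z, b)) (h : ¬ (z = none ∧ m = ∅ ∧ (b || adv) = false))
    (hm' : m ∪ N.contribution (inputTape w k) (z.getD ∅) = m') :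
    B.predictor.step w (B.config (.up adv m) k cells (j + 1) v) =
      B.config (.up (adv && b) (N.shift m')) k
        (Function.update cells j (some {s | (0, s) ∈ m'}, b || adv)) (j + 2) v := by
  subst hm'
  simp only [StreamMachine.step, predictor, config, predictorTrans, StreamMachine.readWork,
    StreamMachine.writeWork, StreamMachine.movedPos, hcell, if_neg h]
  simp

theorem step_back (h : (cells j).2 = false) :
    B.predictor.step w (B.config .back k cells (j + 1) v) = B.config .back k cells j v := by
  obtain ⟨z, hz⟩ : ∃ z, cells j = (z, false) := ⟨_, Prod.ext rfl h⟩
  simp [StreamMachine.step, predictor, config, predictorTrans, StreamMachine.readWork,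
    StreamMachine.writeWork, StreamMachine.movedPos, hz, Function.update_eq_self_iff]

theorem step_back_mark (h : (cells j).2 = true) :
    B.predictor.step w (B.config .back k cells (j + 1) v) =
      B.config (.scan B.start ∅) k cells (j + 1) v := by
  obtain ⟨z, hz⟩ : ∃ z, cells j = (z, true) := ⟨_, Prod.ext rfl h⟩
  simp [StreamMachine.step, predictor, config, predictorTrans, StreamMachine.readWork,
    StreamMachine.writeWork, StreamMachine.movedPos, hz, Function.update_eq_self_iff]

theorem step_scan (x : X) (C : Set S) :
    B.predictor.step w (B.config (.scan x C) k cells (j + 1) v) =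
      B.config (.scan (B.next x) (C ∪ (cells j).1.getD ∅ ∩ B.label x)) k cells j v := by
  simp [StreamMachine.step, predictor, config, predictorTrans, StreamMachine.readWork,
    StreamMachine.writeWork, StreamMachine.movedPos]

theorem step_scan_zero (x : X) (C : Set S) :
    B.predictor.step w (B.config (.scan x C) k cells 0 v) =
      B.config (.start (onlyElement (N.letter '' C)).isSome) (k + 1) cells 0
        (v ++ (onlyElement (N.letter '' C)).toList) := by
  simp [StreamMachine.step, predictor, config, predictorTrans, StreamMachine.readWork,
    StreamMachine.writeWork, StreamMachine.movedPos]

variable {a : Option Sig} {n l i : ℕ} {adv : Bool} {Z : ℕ → Set S}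

/-- The configuration in which the sweep to the right over `table n Z l` arrives at cell `j`. -/
noncomputable def upConfig (n l : ℕ) (adv : Bool) (Z : ℕ → Set S) (a : Option Sig) (k : ℕ)
    (v : List Gam) (j : ℕ) : B.predictor.Config :=
  B.config (.up (adv && decide (j ≤ l)) (N.pending a Z j j)) k
    (splice j (fun i => (some (N.layerStep a Z i), decide (i < l + adv.toNat))) (table n Z l))
    (j + 1) v

theorem step_start_table : B.predictor.step w (B.config (.start adv) k (table n Z l) 0 v) =
    B.upConfig n l adv Z (inputTape w k) k v 0 := by
  rw [step_start, N.pending_zero_congr _ _ Z]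
  simp [upConfig, splice_zero]

theorem step_upConfig (hZ : ∀ j, n ≤ j → Z j = ∅)
    (h : ¬ (n ≤ j ∧ N.pending (inputTape w k) Z j j = ∅ ∧ l + adv.toNat ≤ j)) :
    B.predictor.step w (B.upConfig n l adv Z (inputTape w k) k v j) =
      B.upConfig n l adv Z (inputTape w k) k v (j + 1) := by
  have hmark : (decide (j < l) || (adv && decide (j ≤ l))) = decide (j < l + adv.toNat) := by
    cases adv <;> grind
  have hadv : (adv && decide (j ≤ l) && decide (j < l)) = (adv && decide (j + 1 ≤ l)) := by
    cases adv <;> grind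
  have hcell : splice j (fun i => (some (N.layerStep (inputTape w k) Z i),
      decide (i < l + adv.toNat))) (table n Z l) j = ((table n Z l j).1, decide (j < l)) := by
    simp [splice, table]
  rw [upConfig, B.step_up hcell ?_ (m' := N.pending (inputTape w k) Z (j + 1) j) ?_, hmark, hadv,
    shift_pending, setOf_zero_mem_pending, upConfig, ← update_splice]
  · rw [hmark]
    rintro ⟨hend, hpending, hle⟩
    exact h ⟨by simpa [table] using hend, hpending, by simpa using hle⟩
  · rw [table_fst_getD hZ, pending_union_contribution]

theorem step_upConfig_halt (hn : n ≤ j) (hpending : N.pending (inputTape w k) Z j j = ∅)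
    (hl : l + adv.toNat ≤ j) :
    B.predictor.step w (B.upConfig n l adv Z (inputTape w k) k v j) =
      B.config .back k (table j (N.layerStep (inputTape w k) Z) (l + adv.toNat)) j v := by
  have hadv : (adv && decide (j ≤ l)) = false := by
    cases adv <;> simp at hl ⊢
    omega
  rw [upConfig, hpending, hadv, step_up_halt]
  · congr 1
    ext1 i
    by_cases hi : i < j
    · simp [splice, table, hi]
    · simp [splice, table, hi, show ¬ i < n by omega, show ¬ i < l by omega,
        show ¬ i < l + adv.toNat by omega]
  · simp [splice, table, hn.not_gt, show ¬ j < l by omega]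

theorem exists_reaches_back (hZ : ∀ j, n ≤ j → Z j = ∅) :
    ∃ n', l + adv.toNat ≤ n' ∧ (∀ j, n' ≤ j → N.layerStep (inputTape w k) Z j = ∅) ∧
      B.predictor.Reaches w (B.config (.start adv) k (table n Z l) 0 v)
        (B.config .back k (table n' (N.layerStep (inputTape w k) Z) (l + adv.toNat)) n' v) := by
  classical
  have hex : ∃ j, n ≤ j ∧ N.pending (inputTape w k) Z j j = ∅ ∧ l + adv.toNat ≤ j :=
    ⟨n + N.maxWeight + 1 + (l + adv.toNat), by omega, N.pending_eq_empty _ hZ (by omega), by omega⟩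
  have hup : ∀ j ≤ Nat.find hex, B.predictor.Reaches w
      (B.config (.start adv) k (table n Z l) 0 v)
      (B.upConfig n l adv Z (inputTape w k) k v j) := by
    intro j hj
    induction j with
    | zero => exact .single B.step_start_table
    | succ j ih => exact (ih (by omega)).tail (B.step_upConfig hZ (Nat.find_min hex hj))
  obtain ⟨hn, hpending, hl⟩ := Nat.find_spec hex
  exact ⟨_, hl, fun j => N.layerStep_eq_empty _ hZ hn hpending,
    (hup _ le_rfl).tail (B.step_upConfig_halt hn hpending hl)⟩

theorem reaches_scan (hi : i < n) :
    B.predictor.Reaches w (B.config .back k (table n Z (i + 1)) n v)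
      (B.config (.scan B.start ∅) k (table n Z (i + 1)) (i + 1) v) := by
  have hback : ∀ d, B.predictor.Reaches w
      (B.config .back k (table n Z (i + 1)) (i + 1 + d) v)
      (B.config .back k (table n Z (i + 1)) (i + 1) v) := by
    intro d
    induction d with
    | zero => exact .refl
    | succ d ih => exact .head (B.step_back (by simp [table]; omega)) ih
  obtain ⟨d, rfl⟩ := Nat.exists_eq_add_of_le hi
  exact (hback d).tail (B.step_back_mark (by simp [table]))

theorem exists_reaches_delimiter (hcells : ∀ j, (cells j).1.getD ∅ = Z j) (i : ℕ) :
    ∃ x, B.predictor.Reaches w (B.config (.scan B.start ∅) k cells (i + 1) v)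
      (B.config (.scan x {s | ∃ j d, s ∈ Z j ∧ N.Total s d ∧ j + d = i}) k cells 0 v) := by
  have hscan : ∀ m ≤ i + 1, B.predictor.Reaches w
      (B.config (.scan B.start ∅) k cells (i + 1) v)
      (B.config (.scan (B.next^[m] B.start) {s | ∃ j d, d < m ∧ s ∈ Z j ∧ N.Total s d ∧ j + d = i})
        k cells (i + 1 - m) v) := by
    intro m hm
    induction m with
    | zero => simpa using Relation.ReflTransGen.refl
    | succ m ih =>
      refine (ih (by omega)).tail ?_
      rw [show i + 1 - m = i - m + 1 by omega, step_scan, ← Function.iterate_succ_apply' B.next,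
        hcells, show i + 1 - (m + 1) = i - m by omega]
      congr 2
      ext s
      simp only [Set.mem_union, Set.mem_inter_iff, B.mem_label_iff, Set.mem_ofPred_eq]
      constructor
      · rintro (⟨j, d, hd, h⟩ | ⟨hs, htotal⟩)
        exacts [⟨j, d, by omega, h⟩, ⟨i - m, m, by omega, hs, htotal, by omega⟩]
      · rintro ⟨j, d, hd, hs, htotal, hi⟩
        rcases Nat.lt_succ_iff_lt_or_eq.1 hd with hd | rfl
        · exact Or.inl ⟨j, d, hd, hs, htotal, hi⟩
        · obtain rfl : j = i - d := by omega
          exact Or.inr ⟨hs, htotal⟩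
  have hbound : {s | ∃ j d, d < i + 1 ∧ s ∈ Z j ∧ N.Total s d ∧ j + d = i} =
      {s | ∃ j d, s ∈ Z j ∧ N.Total s d ∧ j + d = i} := by
    ext s
    exact exists₂_congr fun j d => ⟨And.right, fun h => ⟨by omega, h⟩⟩
  exact ⟨B.next^[i + 1] B.start, by simpa only [hbound, Nat.sub_self] using hscan (i + 1) le_rfl⟩

end WeightAutomaton

/-- The table of reached vertices before cell `k` of the tape of `w` is read. -/
def layer {Sig Gam S : Type*} (N : PathSystem Sig Gam S) (w : ℕ → Sig) : ℕ → ℕ → Set S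
  | 0 => fun _ => ∅
  | k + 1 => N.reach (wordPrefix w k)

theorem layerStep_layer {Sig Gam S : Type*} (N : PathSystem Sig Gam S) (w : ℕ → Sig) (k : ℕ) :
    N.layerStep (inputTape w k) (N.layer w k) = N.layer w (k + 1) := by
  cases k with
  | zero => rfl
  | succ k => rw [layer, layer, wordPrefix_succ, reach_append_singleton, inputTape]

namespace WeightAutomaton

variable {Sig Gam : Type*} {S X : Type} {N : PathSystem Sig Gam S} (B : N.WeightAutomaton X)
  [Finite S] [Finite X] {f : (ℕ → Sig) →. (ℕ → Gam)} {w : ℕ → Sig} {k t : ℕ}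

/-- At time `t` the machine is about to read cell `k` of the tape of `w`, with the intended table,
marks and output. -/
def ReadyAt (f : (ℕ → Sig) →. (ℕ → Gam)) (w : ℕ → Sig) (k t : ℕ) : Prop :=
  ∃ adv n l, (∀ j, n ≤ j → N.layer w k j = ∅) ∧
    l + adv.toNat = (predicted f w k).length + 1 ∧ B.predictor.configAt w t =
      B.config (.start adv) k (table n (N.layer w k) l) 0 (predicted f w k)

theorem readyAt_zero : B.ReadyAt f w 0 0 := by
  have htable : table 0 (N.layer w 0) 0 = fun _ => (none, false) := by
    ext1 j
    simp [table]
  refine ⟨true, 0, 0, fun _ _ => rfl, rfl, ?_⟩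
  rw [predicted, htable]
  rfl

variable {B}

theorem ReadyAt.exists_crosses (hf : N.Describes f) (h : B.ReadyAt f w k t) :
    ∃ t', B.predictor.Crosses w k t' ∧ B.ReadyAt f w (k + 1) (t' + 1) := by
  obtain ⟨adv, n, l, hZ, hmarks, ht⟩ := h
  obtain ⟨n', hl, hZ', hback⟩ := B.exists_reaches_back (k := k) (l := l) (adv := adv)
    (v := predicted f w k) hZ
  rw [layerStep_layer] at hZ' hback
  rw [hmarks] at hl hback
  obtain ⟨x, hscan⟩ := B.exists_reaches_delimiter (w := w) (k := k) (v := predicted f w k)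
    (table_fst_getD hZ' ((predicted f w k).length + 1)) (predicted f w k).length
  obtain ⟨t', ht'⟩ := StreamMachine.exists_configAt_eq
    (ht ▸ (hback.trans (B.reaches_scan hl)).trans hscan)
  have hnext : B.predictor.configAt w (t' + 1) =
      B.config (.start (onlyElement (outputLetters f (wordPrefix w k)
        (predicted f w k).length)).isSome) (k + 1)
        (table n' (N.layer w (k + 1)) ((predicted f w k).length + 1)) 0
        (predicted f w (k + 1)) := by
    rw [StreamMachine.configAt_succ, ht', step_scan_zero, predicted, hf.outputLetters_eq]
    rfl
  refine ⟨t', ⟨by rw [ht']; rfl, by rw [hnext]; rfl⟩, _, n', _, hZ', ?_, hnext⟩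
  rw [predicted, List.length_append]
  cases onlyElement (outputLetters f (wordPrefix w k) (predicted f w k).length) <;> rfl

variable (B) in
theorem outputUpTo_predictor (hf : N.Describes f) (w : ℕ → Sig) (k : ℕ) :
    B.predictor.outputUpTo w k = predicted f w (k + 1) := by
  have hready : ∀ k, ∃ t, B.ReadyAt f w k t := fun k => by
    induction k with
    | zero => exact ⟨0, B.readyAt_zero⟩
    | succ k ih =>
      obtain ⟨t, ht⟩ := ih
      obtain ⟨t', -, ht'⟩ := ht.exists_crosses hf
      exact ⟨t' + 1, ht'⟩
  obtain ⟨t, ht⟩ := hready k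
  obtain ⟨t', hcross, _, _, _, -, -, hconfig⟩ := ht.exists_crosses hf
  rw [hcross.outputUpTo_eq, hconfig, config]

end WeightAutomaton

theorem Describes.isComputableFunction {Sig Gam : Type*} {S : Type} [Finite S]
    {N : PathSystem Sig Gam S} {f : (ℕ → Sig) →. (ℕ → Gam)} (hf : N.Describes f)
    (hforced : ∀ x, ∀ y ∈ f x, ∀ i, ∃ k, outputLetters f (wordPrefix x k) i = {y i}) :
    IsComputableFunction f := by
  obtain ⟨n, ⟨B⟩⟩ := N.exists_weightAutomaton_fin
  refine ⟨B.predictor, fun x y hy i => ?_⟩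
  obtain ⟨k, hk⟩ := exists_le_length_predicted hy (hforced x y hy) i
  have hlength : i ≤ (predicted f x (k + 1)).length :=
    hk.trans (monotone_length_predicted f x (Nat.le_succ k))
  refine ⟨k, ?_⟩
  rw [B.outputUpTo_predictor hf, predicted_eq_wordPrefix hy]
  exact wordPrefix_prefix_wordPrefix y hlength

end PathSystem

/-! ### Acyclic relations -/

section Acyclic

open Relation

variable {α β : Type*} {r : α → α → Prop}

theorem injective_of_acyclic (hr : ∀ a, ¬ TransGen r a a) {ρ : ℕ → α}
    (hρ : ∀ n, r (ρ n) (ρ (n + 1))) : Function.Injective ρ := by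
  refine .of_lt_imp_ne fun m n hmn heq => hr (ρ m) ?_
  have hpath : TransGen r (ρ m) (ρ n) :=
    (transGen_of_succ_of_lt (fun i j => r (ρ i) (ρ j)) (fun i _ => hρ i) hmn).lift ρ fun _ _ h => h
  rwa [← heq] at hpath

theorem wellFounded_of_acyclic_of_invImage (hr : ∀ a, ¬ TransGen r a a) {f : β → α}
    (hf : (Set.range f)ᶜ.Finite) (h : WellFounded (InvImage r f)) : WellFounded r := by
  refine wellFounded_iff_isEmpty_descending_chain.2 ⟨fun ⟨c, hc⟩ => ?_⟩
  have hinj : Function.Injective c :=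
    injective_of_acyclic (r := Function.swap r) (fun a ha => hr a (transGen_swap.1 ha)) hc
  obtain ⟨K, hK⟩ := (hf.preimage hinj.injOn).bddAbove
  have hrange : ∀ k, ∃ b, f b = c (K + 1 + k) := fun k => by
    by_contra hk
    have hle : K + 1 + k ≤ K := hK hk
    omega
  choose d hd using hrange
  refine (wellFounded_iff_isEmpty_descending_chain.1 h).false ⟨d, fun k => ?_⟩
  rw [InvImage, hd, hd]
  exact hc (K + 1 + k)

end Acyclic

/-! ### Local descriptions of accepting runs -/

namespace HeadDir

instance : Finite HeadDir :=
  .of_surjective (fun b : Bool => if b then right else left) fun δ => by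
    cases δ
    exacts [⟨false, rfl⟩, ⟨true, rfl⟩]

/-- The reverse direction. -/
def opposite : HeadDir → HeadDir
  | left => right
  | right => left

/-- A move in direction `δ` leads from cell `i` to cell `j`; no move leads to the left from
cell `0`. -/
def Moves : HeadDir → ℕ → ℕ → Prop
  | left, i, j => i = j + 1
  | right, i, j => j = i + 1

theorem moves_opposite {δ : HeadDir} {i j : ℕ} : δ.opposite.Moves i j ↔ δ.Moves j i := by
  cases δ <;> rfl

theorem moves_succ_succ {δ : HeadDir} {i j : ℕ} : δ.Moves (i + 1) (j + 1) ↔ δ.Moves i j := by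
  cases δ <;> simp [Moves]

theorem Moves.right_unique {δ : HeadDir} {i j j' : ℕ} (h : δ.Moves i j) (h' : δ.Moves i j') :
    j = j' := by
  cases δ <;> simp only [Moves] at h h' <;> omega

theorem Moves.dir_unique {δ δ' : HeadDir} {i j : ℕ} (h : δ.Moves i j) (h' : δ'.Moves i j) :
    δ = δ' := by
  cases δ <;> cases δ' <;> simp only [Moves] at h h' <;> first | rfl | omega

theorem exists_moves {δ : HeadDir} {i : ℕ} (h : i = 0 → δ = right) : ∃ j, δ.Moves i j := by
  cases δ with
  | right => exact ⟨i + 1, rfl⟩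
  | left => exact (Nat.exists_eq_succ_of_ne_zero fun hi => nomatch h hi).imp fun _ hj => hj

theorem eq_or_eq_opposite (δ δ' : HeadDir) : δ' = δ ∨ δ' = δ.opposite := by
  cases δ <;> cases δ' <;> simp [opposite]

end HeadDir

namespace TwoWayTransducer

variable {Sig Gam : Type*} (T : TwoWayTransducer Sig Gam)

/-- The information attached to one cell of the tape, relative to a distinguished step `t₀` of an
accepting run. The `phase` of a state is `none` if the run is never in that state at this cell, and
otherwise compares the step at which it is with `t₀`. The states in `entered δ` are reached by
a move in direction `δ`, `before` is the order of the visits in time, and `letter` is the letter at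
position `off` of the output of step `t₀`. -/
structure CellInfo (L : ℕ) where
  sym : Option Sig
  letter : Gam
  ahead : Set T.Ahead
  behind : T.Behind
  phase : T.State → Option Ordering
  entered : HeadDir → Set T.State
  before : T.State → T.State → Prop
  off : Fin L

variable {T} {L : ℕ}

namespace CellInfo

instance [Finite Sig] [Finite Gam] : Finite (T.CellInfo L) := by
  have := T.finState
  have := T.finAhead
  have := T.finBehind
  have : Finite (T.State → T.State → Prop) := inferInstance
  refine .of_injective (β := Option Sig × Gam × Set T.Ahead × T.Behind ×
    (T.State → Option Ordering) × (HeadDir → Set T.State) × (T.State → T.State → Prop) × Fin L)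
    (fun s => (s.sym, s.letter, s.ahead, s.behind, s.phase, s.entered, s.before, s.off)) ?_
  rintro ⟨⟩ ⟨⟩ h
  simpa using h

/-- The transition `r` is possible in state `q` at a cell with the given information. -/
def Act (s : T.CellInfo L) (q : T.State) (r : T.State × List Gam × HeadDir) : Prop :=
  ∃ p ∈ s.ahead, T.trans q s.sym p s.behind = some r

/-- The conditions that concern a single cell. -/
structure Valid (s : T.CellInfo L) : Prop where
  behind_start : s.sym = none → s.behind = T.lookBehind.start
  act : ∀ q, s.phase q ≠ none →
    ∃ q' g δ, s.Act q (q', g, δ) ∧ (s.sym = none → δ = HeadDir.right)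
  phase_init : s.sym = none → ∃ a, s.phase T.init = some a ∧ a ≠ .gt
  entered : ∀ q, s.phase q ≠ none → (s.sym = none ∧ q = T.init) ∨ ∃ δ, q ∈ s.entered δ
  entered_start : s.sym = none → s.entered HeadDir.right = ∅
  before_irrefl : ∀ q, ¬ s.before q q
  before_trans : ∀ q q' q'', s.before q q' → s.before q' q'' → s.before q q''
  letter_off : ∀ q q' g δ, s.phase q = some .eq → s.Act q (q', g, δ) →
    g[(s.off : ℕ)]? = some s.letter

/-- The comparisons of two consecutive steps with `t₀`. -/
def PhaseStep (a b : Ordering) : Prop :=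
  a = .lt ↔ b ≠ .gt

/-- The conditions on the moves between a cell and its neighbour in direction `δ`. By `turn`, an
excursion to the neighbour that starts in state `a` and ends in state `d` respects the order of the
visits. -/
structure Link (δ : HeadDir) (s s' : T.CellInfo L) : Prop where
  phase : ∀ q q' g a, s.phase q = some a → s.Act q (q', g, δ) →
    ∃ b, s'.phase q' = some b ∧ PhaseStep a b
  entered : ∀ q ∈ s'.entered δ, s'.phase q ≠ none →
    ∃ q' g, s.phase q' ≠ none ∧ s.Act q' (q, g, δ)
  turn : ∀ a b c d g g', s.phase a ≠ none → s'.phase c ≠ none → s.Act a (b, g, δ) →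
    s'.Act c (d, g', δ.opposite) → (b = c ∨ s'.before b c) → s.before a d

/-- Compatibility of the information at two neighbouring cells. -/
structure Edge (s s' : T.CellInfo L) : Prop where
  valid : s.Valid
  sym : s'.sym ≠ none
  letter : s'.letter = s.letter
  ahead : s.ahead = {p | ∃ p' ∈ T.lookAhead.step p s.sym, p' ∈ s'.ahead}
  behind : s'.behind = T.lookBehind.step s.behind s.sym
  right : Link HeadDir.right s s'
  left : Link HeadDir.left s' s

/-- The length of the output of the transition that is possible in state `q`. -/
noncomputable def outLength (s : T.CellInfo L) (q : T.State) : ℕ :=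
  sSup {n | ∃ r, s.Act q r ∧ r.2.1.length = n}

/-- The number of letters that are output in state `q` before the distinguished letter. -/
noncomputable def stateWeight (s : T.CellInfo L) (q : T.State) : ℕ :=
  match s.phase q with
  | some .lt => s.outLength q
  | some .eq => s.off
  | _ => 0

end CellInfo

section Labelling

variable {σ : ℕ → T.CellInfo L} {δ : HeadDir} {c d e : T.State × ℕ} {g : List Gam}

/-- A move between configurations, according to the information attached to the cells. -/
def Move (σ : ℕ → T.CellInfo L) (δ : HeadDir) (c : T.State × ℕ) (g : List Gam)
    (c' : T.State × ℕ) : Prop :=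
  (σ c.2).Act c.1 (c'.1, g, δ) ∧ δ.Moves c.2 c'.2

/-- The configuration `c` is visited, according to the information attached to the cells. -/
def Visited (σ : ℕ → T.CellInfo L) (c : T.State × ℕ) : Prop :=
  (σ c.2).phase c.1 ≠ none

/-- The configuration `c` is visited and followed by `d`, which is next to it in direction `δ`. -/
def NextAlong (σ : ℕ → T.CellInfo L) (δ : HeadDir) (c d : T.State × ℕ) : Prop :=
  Visited σ c ∧ ∃ g, Move σ δ c g d

/-- The configuration `c` is visited and followed by `d`. -/
def Next (σ : ℕ → T.CellInfo L) (c d : T.State × ℕ) : Prop :=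
  ∃ δ, NextAlong σ δ c d

/-- Two configurations at the same cell are visited in the given order. -/
def Earlier (σ : ℕ → T.CellInfo L) (c d : T.State × ℕ) : Prop :=
  c.2 = d.2 ∧ (σ c.2).before c.1 d.1

/-- The configuration `d` is at the cell next to that of `c` in direction `δ`, and it is the
successor of `c` or visited later than this successor. -/
def Climb (σ : ℕ → T.CellInfo L) (δ : HeadDir) (c d : T.State × ℕ) : Prop :=
  ∃ e, NextAlong σ δ c e ∧ (e = d ∨ Earlier σ e d)

theorem link_of_moves (hσ : ∀ n, (σ n).Edge (σ (n + 1))) {i j : ℕ} (h : δ.Moves i j) :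
    CellInfo.Link δ (σ i) (σ j) := by
  cases δ with
  | left => exact h ▸ (hσ j).left
  | right => exact h ▸ (hσ i).right

theorem Earlier.trans (hσ : ∀ n, (σ n).Edge (σ (n + 1))) (h : Earlier σ c d)
    (h' : Earlier σ d e) : Earlier σ c e :=
  ⟨h.1.trans h'.1, (hσ _).valid.before_trans _ _ _ h.2 (h.1 ▸ h'.2)⟩

theorem Climb.moves (h : Climb σ δ c d) : δ.Moves c.2 d.2 := by
  obtain ⟨e, ⟨-, g, -, hmoves⟩, rfl | he⟩ := h
  exacts [hmoves, he.1 ▸ hmoves]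

theorem snd_ne_of_transGen_climb (h : Relation.TransGen (Climb σ δ) c d) : c.2 ≠ d.2 := by
  have hpath : Relation.TransGen δ.Moves c.2 d.2 := h.lift Prod.snd fun _ _ => Climb.moves
  cases δ with
  | left =>
    refine (Relation.TransGen.trans_induction_on (motive := fun {i j} _ => j < i) hpath
      (fun h => ?_) fun _ _ h h' => h'.trans h).ne'
    exact h ▸ Nat.lt_succ_self _
  | right =>
    refine (Relation.TransGen.trans_induction_on (motive := fun {i j} _ => i < j) hpath
      (fun h => ?_) fun _ _ h h' => h.trans h').ne
    exact h ▸ Nat.lt_succ_self _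

theorem Climb.earlier_of_nextAlong_opposite (hσ : ∀ n, (σ n).Edge (σ (n + 1)))
    (h : Climb σ δ c d) (h' : NextAlong σ δ.opposite d e) : Earlier σ c e := by
  have hmoves := h.moves
  obtain ⟨x, ⟨hc, g, hact, -⟩, hx⟩ := h
  obtain ⟨hd, g', hact', hmoves'⟩ := h'
  refine ⟨(HeadDir.moves_opposite.2 hmoves).right_unique hmoves', ?_⟩
  refine (link_of_moves hσ hmoves).turn _ _ _ _ g g' hc hd hact hact' ?_
  exact hx.imp (congrArg Prod.fst) fun h : Earlier σ x d => h.1 ▸ h.2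

/-- The path from `c` to `d` returns to the cell of `c`, or it ends beyond this cell in
direction `δ`; the climbs are the last crossings of the cell borders in between. -/
def Excursion (σ : ℕ → T.CellInfo L) (c d : T.State × ℕ) : Prop :=
  ∃ δ e, (c = e ∨ Earlier σ c e) ∧ Relation.TransGen (Climb σ δ) e d

theorem earlier_or_excursion_of_next (hσ : ∀ n, (σ n).Edge (σ (n + 1)))
    (h : c = d ∨ Earlier σ c d ∨ Excursion σ c d) (h' : Next σ d e) :
    Earlier σ c e ∨ Excursion σ c e := by
  obtain ⟨ε, hε⟩ := h'
  have hclimb : Climb σ ε d e := ⟨e, hε, .inl rfl⟩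
  rcases h with h | h | ⟨δ, x, hx, hpath⟩
  · exact .inr ⟨ε, d, .inl h, .single hclimb⟩
  · exact .inr ⟨ε, d, .inr h, .single hclimb⟩
  · rcases HeadDir.eq_or_eq_opposite δ ε with rfl | rfl
    · exact .inr ⟨ε, x, hx, hpath.tail hclimb⟩
    · obtain ⟨y, hxy, hyd⟩ := Relation.TransGen.tail'_iff.1 hpath
      have hye : Earlier σ y e := hyd.earlier_of_nextAlong_opposite hσ hε
      rcases Relation.reflTransGen_iff_eq_or_transGen.1 hxy with rfl | hxy
      · exact .inl (hx.elim (fun h => h ▸ hye) fun h => h.trans hσ hye)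
      · obtain ⟨z, hxz, u, hzu, hu⟩ := Relation.TransGen.tail'_iff.1 hxy
        have hue : Earlier σ u e := hu.elim (fun h => h ▸ hye) fun h => h.trans hσ hye
        exact .inr ⟨δ, x, hx, .tail' hxz ⟨u, hzu, .inr hue⟩⟩

theorem not_transGen_next (hσ : ∀ n, (σ n).Edge (σ (n + 1))) (c : T.State × ℕ) :
    ¬ Relation.TransGen (Next σ) c c := by
  have hpath : ∀ d, Relation.TransGen (Next σ) c d → Earlier σ c d ∨ Excursion σ c d :=
    fun d h => by
      induction h with
      | single h => exact earlier_or_excursion_of_next hσ (.inl rfl) h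
      | tail _ h ih => exact earlier_or_excursion_of_next hσ (.inr ih) h
  intro h
  rcases hpath c h with ⟨-, h⟩ | ⟨δ, e, he, h⟩
  · exact (hσ _).valid.before_irrefl _ h
  · exact snd_ne_of_transGen_climb h (he.elim (congrArg Prod.snd) fun h => h.1).symm

/-- The look-ahead sets are eventually the right ones. -/
def AheadEventually (σ : ℕ → T.CellInfo L) : Prop :=
  ∀ᶠ n in atTop, (σ n).ahead = {p | (fun k => (σ (n + k)).sym) ∈ T.lookAhead.langFrom p}

/-- Acceptance of a labelling of the tape. Well-foundedness says that every visited configuration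
is reached from the initial one. -/
structure Accepting (σ : ℕ → T.CellInfo L) : Prop where
  wellFounded : WellFounded (Next σ)
  ahead : AheadEventually σ
  muller : {q | ∃ᶠ n in atTop, (σ n).phase q ≠ none} ∈ T.acc
  past : ∀ᶠ n in atTop, ∀ q, (σ n).phase q ≠ some .lt

theorem wellFounded_next_tail_iff (hσ : ∀ n, (σ n).Edge (σ (n + 1))) :
    WellFounded (Next fun n => σ (n + 1)) ↔ WellFounded (Next σ) := by
  have hshift : Next (fun n => σ (n + 1)) = InvImage (Next σ) (Prod.map id Nat.succ) := by
    funext c d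
    simp [Next, NextAlong, Move, Visited, InvImage, HeadDir.moves_succ_succ]
  have := T.finState
  rw [hshift]
  refine ⟨wellFounded_of_acyclic_of_invImage (not_transGen_next hσ) ?_, InvImage.wf _⟩
  refine (Set.finite_univ.prod (Set.finite_singleton 0)).subset ?_
  rintro ⟨q, _ | n⟩ h
  exacts [⟨trivial, rfl⟩, absurd ⟨(q, n), rfl⟩ h]

theorem aheadEventually_tail_iff : AheadEventually (fun n => σ (n + 1)) ↔ AheadEventually σ := by
  unfold AheadEventually
  nth_rw 2 [← map_add_atTop_eq_nat 1]
  simp only [eventually_map, add_right_comm]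

theorem accepting_tail_iff (hσ : ∀ n, (σ n).Edge (σ (n + 1))) :
    Accepting (fun n => σ (n + 1)) ↔ Accepting σ := by
  have hmuller : {q | ∃ᶠ n in atTop, (σ (n + 1)).phase q ≠ none} =
      {q | ∃ᶠ n in atTop, (σ n).phase q ≠ none} := by
    nth_rw 2 [← map_add_atTop_eq_nat 1]
    simp only [frequently_map]
  have hpast : (∀ᶠ n in atTop, ∀ q, (σ (n + 1)).phase q ≠ some .lt) ↔
      ∀ᶠ n in atTop, ∀ q, (σ n).phase q ≠ some .lt := by
    nth_rw 2 [← map_add_atTop_eq_nat 1]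
    simp only [eventually_map]
  constructor
  · rintro ⟨hwf, hahead, hacc, hlt⟩
    exact ⟨(wellFounded_next_tail_iff hσ).1 hwf, aheadEventually_tail_iff.1 hahead,
      hmuller ▸ hacc, hpast.1 hlt⟩
  · rintro ⟨hwf, hahead, hacc, hlt⟩
    exact ⟨(wellFounded_next_tail_iff hσ).2 hwf, aheadEventually_tail_iff.2 hahead,
      hmuller ▸ hacc, hpast.2 hlt⟩

end Labelling

variable (T L)

/-- The path system of the local descriptions of accepting runs. -/
noncomputable def pathSystem : PathSystem Sig Gam (T.CellInfo L) where
  edge := CellInfo.Edge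
  weight s := ∑ᶠ q, s.stateWeight q
  sym := CellInfo.sym
  letter := CellInfo.letter
  acc := Accepting
  acc_tail _ := accepting_tail_iff
  edge_sym _ _ h := h.sym
  edge_letter _ _ h := h.letter

end TwoWayTransducer

/-! ### Runs and the labellings of the tape -/

theorem inputTape_eq_none_iff {α : Type*} {w : ℕ → α} {n : ℕ} : inputTape w n = none ↔ n = 0 := by
  cases n <;> simp [inputTape]

namespace TwoWayTransducer

variable {Sig Gam : Type*} {T : TwoWayTransducer Sig Gam} {L : ℕ}

section Runs

variable {w : ℕ → Sig}

theorem behindState_succ (w : ℕ → Sig) (n : ℕ) :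
    T.behindState w (n + 1) = T.lookBehind.step (T.behindState w n) (inputTape w n) := by
  simp [behindState, wordPrefix_succ]

theorem aheadHolds_iff (w : ℕ → Sig) (n : ℕ) (p : T.Ahead) :
    T.AheadHolds w n p ↔
      ∃ p' ∈ T.lookAhead.step p (inputTape w n), T.AheadHolds w (n + 1) p' := by
  rw [AheadHolds, MullerAutomaton.mem_langFrom_iff]
  simp only [AheadHolds, add_zero, add_right_comm, add_assoc]

theorem step_iff {c c' : T.State × ℕ} {g : List Gam} :
    T.Step w c g c' ↔ ∃ δ : HeadDir, (∃ p, T.AheadHolds w c.2 p ∧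
      T.transAt w c.1 c.2 p = some (c'.1, g, δ)) ∧ δ.Moves c.2 c'.2 := by
  constructor
  · rintro ⟨p, hp, h | h⟩
    exacts [⟨.right, ⟨p, hp, h.1⟩, h.2⟩, ⟨.left, ⟨p, hp, h.1⟩, h.2⟩]
  · rintro ⟨_ | _, ⟨p, hp, h⟩, hmoves⟩
    exacts [⟨p, hp, .inr ⟨h, hmoves⟩⟩, ⟨p, hp, .inl ⟨h, hmoves⟩⟩]

theorem IsDeterministic.trans_unique (hT : T.IsDeterministic) {q : T.State} {n : ℕ}
    {p p' : T.Ahead} {r r' : T.State × List Gam × HeadDir} (hp : T.AheadHolds w n p)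
    (hp' : T.AheadHolds w n p') (hr : T.transAt w q n p = some r)
    (hr' : T.transAt w q n p' = some r') : r = r' := by
  obtain rfl := hT w q n p p' hp hp' (by simp [hr]) (by simp [hr'])
  simpa [hr] using hr'

theorem IsDeterministic.step_unique (hT : T.IsDeterministic) {c d d' : T.State × ℕ}
    {g g' : List Gam} (h : T.Step w c g d) (h' : T.Step w c g' d') : d = d' := by
  obtain ⟨δ, ⟨p, hp, hr⟩, hmoves⟩ := step_iff.1 h
  obtain ⟨δ', ⟨p', hp', hr'⟩, hmoves'⟩ := step_iff.1 h'
  have heq := hT.trans_unique hp hp' hr hr'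
  simp only [Prod.mk.injEq] at heq
  obtain ⟨hstate, -, rfl⟩ := heq
  exact Prod.ext hstate (hmoves.right_unique hmoves')

theorem IsAcceptingRun.injective (hT : T.IsDeterministic) {ρ : ℕ → T.State × ℕ}
    {γ : ℕ → List Gam} (h : T.IsAcceptingRun w ρ γ) : Function.Injective ρ := by
  refine injective_of_infinite_range (fun m n hmn => ?_) fun hfin => ?_
  · exact hT.step_unique (h.step m) (hmn ▸ h.step n)
  · obtain ⟨k, hk⟩ := (hfin.image Prod.snd).bddAbove
    obtain ⟨t, ht⟩ := h.readsAll (k + 1)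
    exact absurd (hk ⟨ρ t, ⟨t, rfl⟩, rfl⟩) (Nat.not_le_of_lt ht)

theorem exists_le_snd_of_injective {ρ : ℕ → T.State × ℕ} (hρ : Function.Injective ρ) (k : ℕ) :
    ∃ t, k ≤ (ρ t).2 := by
  have := T.finState
  by_contra! h
  refine Set.infinite_range_of_injective hρ
    ((Set.finite_univ.prod (Set.finite_lt_nat k)).subset ?_)
  rintro _ ⟨t, rfl⟩
  exact ⟨trivial, h t⟩

/-- The labelling `σ` is correct about the tape content of `w` and the look-around. -/
structure IsLabelling (w : ℕ → Sig) (σ : ℕ → T.CellInfo L) : Prop where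
  sym : ∀ n, (σ n).sym = inputTape w n
  ahead : ∀ n, (σ n).ahead = {p | T.AheadHolds w n p}
  behind : ∀ n, (σ n).behind = T.behindState w n

variable {σ : ℕ → T.CellInfo L} {δ : HeadDir} {c d : T.State × ℕ} {g : List Gam}

namespace IsLabelling

theorem act_iff (h : IsLabelling w σ) {n : ℕ} {q : T.State} {r : T.State × List Gam × HeadDir} :
    (σ n).Act q r ↔ ∃ p, T.AheadHolds w n p ∧ T.transAt w q n p = some r := by
  simp [CellInfo.Act, transAt, h.sym, h.ahead, h.behind]

theorem move_iff (h : IsLabelling w σ) : (∃ δ, Move σ δ c g d) ↔ T.Step w c g d := by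
  simp only [Move, step_iff, h.act_iff]

theorem act_unique (h : IsLabelling w σ) (hT : T.IsDeterministic) {n : ℕ} {q : T.State}
    {r r' : T.State × List Gam × HeadDir} (hr : (σ n).Act q r) (hr' : (σ n).Act q r') :
    r = r' := by
  obtain ⟨p, hp, hr⟩ := h.act_iff.1 hr
  obtain ⟨p', hp', hr'⟩ := h.act_iff.1 hr'
  exact hT.trans_unique hp hp' hr hr'

theorem outLength_eq (h : IsLabelling w σ) (hT : T.IsDeterministic) {n : ℕ} {q : T.State}
    {r : T.State × List Gam × HeadDir} (hr : (σ n).Act q r) :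
    (σ n).outLength q = r.2.1.length := by
  have hlengths : {k | ∃ r, (σ n).Act q r ∧ r.2.1.length = k} = {r.2.1.length} :=
    Set.ext fun k => ⟨fun ⟨_, hr', hk⟩ => hk ▸ h.act_unique hT hr' hr ▸ rfl,
      fun hk => ⟨r, hr, hk.symm⟩⟩
  rw [CellInfo.outLength, hlengths, csSup_singleton]

end IsLabelling

theorem ahead_eq_of_edges (hσ : ∀ n, (σ n).Edge (σ (n + 1))) (ha : AheadEventually σ)
    (hs : ∀ n, (σ n).sym = inputTape w n) (n : ℕ) : (σ n).ahead = {p | T.AheadHolds w n p} := by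
  simp only [AheadEventually, hs] at ha
  obtain ⟨m, hm⟩ := eventually_atTop.1 ha
  refine (le_total m n).elim (hm n) fun hle => ?_
  induction hle using Nat.decreasingInduction with
  | self => exact hm m le_rfl
  | of_succ k _ ih =>
    ext p
    simp only [(hσ k).ahead, ih, Set.mem_ofPred_eq, aheadHolds_iff w k p, hs]

theorem behind_eq_of_edges (hσ : ∀ n, (σ n).Edge (σ (n + 1)))
    (hs : ∀ n, (σ n).sym = inputTape w n) (n : ℕ) : (σ n).behind = T.behindState w n := by
  induction n with
  | zero => exact (hσ 0).valid.behind_start (hs 0)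
  | succ n ih => rw [(hσ n).behind, ih, behindState_succ, hs]

/-- The labelling `σ` records the run with configurations `ρ` and outputs `γ`, relative to the
step `t₀`. -/
structure Traces (σ : ℕ → T.CellInfo L) (ρ : ℕ → T.State × ℕ) (γ : ℕ → List Gam) (t₀ : ℕ) :
    Prop where
  injective : Function.Injective ρ
  move : ∀ t, ∃ δ, Move σ δ (ρ t) (γ t) (ρ (t + 1))
  phase : ∀ t, (σ (ρ t).2).phase (ρ t).1 = some (compare t t₀)
  exists_of_visited : ∀ c, Visited σ c → ∃ t, ρ t = c

theorem infSet_fst_eq {ρ : ℕ → T.State × ℕ} (hρ : Function.Injective ρ)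
    (hvisited : ∀ c, Visited σ c ↔ ∃ t, ρ t = c) :
    infSet (fun t => (ρ t).1) = {q | ∃ᶠ n in atTop, (σ n).phase q ≠ none} := by
  ext q
  simp only [infSet, Set.mem_ofPred_eq, Nat.frequently_atTop_iff_infinite]
  have himage : {n | (σ n).phase q ≠ none} = (fun t => (ρ t).2) '' {t | (ρ t).1 = q} := by
    ext n
    refine (hvisited (q, n)).trans ⟨fun ⟨t, ht⟩ => ⟨t, by simp [ht], by simp [ht]⟩, ?_⟩
    rintro ⟨t, hq, hn⟩
    exact ⟨t, Prod.ext hq hn⟩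
  rw [himage, Set.infinite_image_iff]
  exact fun s hs t ht hst => hρ (Prod.ext (Eq.trans hs ht.symm) hst)

theorem Traces.hasTotal {ρ : ℕ → T.State × ℕ} {γ : ℕ → List Gam} {t₀ : ℕ}
    (hρ : Traces σ ρ γ t₀) (hT : T.IsDeterministic) (hσ : IsLabelling w σ) :
    (T.pathSystem L).HasTotal σ
      (∑ t ∈ Finset.range t₀, (γ t).length + (σ (ρ t₀).2).off) := by
  classical
  have := T.finState
  have := Fintype.ofFinite T.State
  have hbound : ∀ᶠ n in atTop, ∀ t ∈ Finset.range (t₀ + 1), (ρ t).2 < n :=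
    (Filter.eventually_all_finset _).2 fun t _ => eventually_gt_atTop _
  have hlt : ∀ t ∈ Finset.range t₀, (σ (ρ t).2).stateWeight (ρ t).1 = (γ t).length := by
    intro t ht
    obtain ⟨δ, hact, -⟩ := hρ.move t
    rw [CellInfo.stateWeight, hρ.phase, compare_lt_iff_lt.2 (Finset.mem_range.1 ht)]
    exact hσ.outLength_eq hT hact
  have heq : (σ (ρ t₀).2).stateWeight (ρ t₀).1 = (σ (ρ t₀).2).off := by
    rw [CellInfo.stateWeight, hρ.phase, compare_eq_iff_eq.2 rfl]
  filter_upwards [hbound] with n hn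
  simp only [pathSystem, finsum_eq_sum_of_fintype]
  rw [← Finset.sum_product' (f := fun k q => (σ k).stateWeight q), ← heq,
    ← Finset.sum_congr rfl hlt, ← Finset.sum_range_succ fun t => (σ (ρ t).2).stateWeight (ρ t).1]
  refine (Finset.sum_of_injOn (fun t => (ρ t).swap) ?_ ?_ ?_ fun _ _ => rfl).symm
  · exact (Prod.swap_injective.comp hρ.injective).injOn
  · exact fun t ht => by simpa using hn t ht
  · rintro ⟨k, q⟩ - hkq
    by_cases hvisited : Visited σ (q, k)
    · obtain ⟨t, ht⟩ := hρ.exists_of_visited _ hvisited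
      have hgt : t₀ < t := by
        by_contra! hle
        exact hkq ⟨t, by simpa using Nat.lt_succ_of_le hle, by simp [ht]⟩
      have hphase := hρ.phase t
      rw [ht, compare_gt_iff_gt.2 hgt] at hphase
      simp [CellInfo.stateWeight, hphase]
    · simp [CellInfo.stateWeight, not_not.1 hvisited]

theorem CellInfo.phase_eq_of_phaseStep {φ : ℕ → Ordering}
    (hφ : ∀ t, PhaseStep (φ t) (φ (t + 1))) (h0 : φ 0 ≠ .gt) (hne : ∃ t, φ t ≠ .lt) :
    ∃ t₀, ∀ t, φ t = compare t t₀ := by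
  classical
  have hlt : ∀ t < Nat.find hne, φ t = .lt := fun t ht => not_not.1 (Nat.find_min hne ht)
  have hfind : φ (Nat.find hne) ≠ .gt := by
    rcases h : Nat.find hne with _ | t
    · exact h0
    · exact (hφ t).1 (hlt t (by omega))
  have hgt : ∀ t, φ t ≠ .lt → φ (t + 1) = .gt := fun t ht => by
    by_contra h
    exact ht ((hφ t).2 h)
  have hafter : ∀ t, Nat.find hne < t → φ t = .gt := fun t ht => by
    induction t, ht using Nat.le_induction with
    | base => exact hgt _ (Nat.find_spec hne)
    | succ t _ ih => exact hgt t (by simp [ih])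
  refine ⟨Nat.find hne, fun t => ?_⟩
  rcases lt_trichotomy t (Nat.find hne) with h | rfl | h
  · rw [hlt t h, compare_lt_iff_lt.2 h]
  · rw [compare_eq_iff_eq.2 rfl]
    cases hphase : φ (Nat.find hne) with
    | lt => exact absurd hphase (Nat.find_spec hne)
    | eq => rfl
    | gt => exact absurd hphase hfind
  · rw [hafter t h, compare_gt_iff_gt.2 h]

theorem exists_nextAlong (hσ : ∀ n, (σ n).Edge (σ (n + 1)))
    (hs : ∀ n, (σ n).sym = inputTape w n) (hc : Visited σ c) : ∃ δ d, NextAlong σ δ c d := by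
  obtain ⟨q', g, δ, hact, hδ⟩ := (hσ c.2).valid.act c.1 hc
  obtain ⟨j, hj⟩ := HeadDir.exists_moves fun h => hδ ((hs c.2).trans (inputTape_eq_none_iff.2 h))
  exact ⟨δ, (q', j), hc, g, hact, hj⟩

theorem exists_next_of_ne_init (hσ : ∀ n, (σ n).Edge (σ (n + 1)))
    (hs : ∀ n, (σ n).sym = inputTape w n) (hc : Visited σ c) (hne : c ≠ (T.init, 0)) :
    ∃ d, Next σ d c := by
  have hnone : (σ c.2).sym = none ↔ c.2 = 0 := hs c.2 ▸ inputTape_eq_none_iff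
  rcases (hσ c.2).valid.entered c.1 hc with ⟨hsym, hq⟩ | ⟨δ, hδ⟩
  · exact absurd (Prod.ext hq (hnone.1 hsym)) hne
  · obtain ⟨j, hj⟩ : ∃ j, δ.opposite.Moves c.2 j := HeadDir.exists_moves fun h => by
      cases δ with
      | left => rfl
      | right => exact ((hσ c.2).valid.entered_start (hnone.2 h) ▸ hδ).elim
    have hj : δ.Moves j c.2 := HeadDir.moves_opposite.1 hj
    obtain ⟨q', g, hq', hact⟩ := (link_of_moves hσ hj).entered c.1 hδ hc
    exact ⟨(q', j), δ, hq', g, hact, hj⟩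

theorem NextAlong.exists_phase (hσ : ∀ n, (σ n).Edge (σ (n + 1))) (h : NextAlong σ δ c d)
    {a : Ordering} (ha : (σ c.2).phase c.1 = some a) :
    ∃ b, (σ d.2).phase d.1 = some b ∧ CellInfo.PhaseStep a b := by
  obtain ⟨-, g, hact, hmoves⟩ := h
  exact (link_of_moves hσ hmoves).phase _ _ g a ha hact

theorem exists_run (hσ : ∀ n, (σ n).Edge (σ (n + 1))) (hs : ∀ n, (σ n).sym = inputTape w n) :
    ∃ (ρ : ℕ → T.State × ℕ) (γ : ℕ → List Gam) (φ : ℕ → Ordering), ρ 0 = (T.init, 0) ∧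
      φ 0 ≠ .gt ∧ ∀ t, (∃ δ, Move σ δ (ρ t) (γ t) (ρ (t + 1))) ∧
      (σ (ρ t).2).phase (ρ t).1 = some (φ t) ∧ CellInfo.PhaseStep (φ t) (φ (t + 1)) := by
  let Phased := {x : (T.State × ℕ) × Ordering // (σ x.1.2).phase x.1.1 = some x.2}
  obtain ⟨a, ha, hne⟩ := (hσ 0).valid.phase_init (hs 0)
  have hnext : ∀ x : Phased, ∃ y : Phased, ∃ g, (∃ δ, Move σ δ x.1.1 g y.1.1) ∧
      CellInfo.PhaseStep x.1.2 y.1.2 := by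
    rintro ⟨⟨c, a⟩, hca⟩
    obtain ⟨δ, d, hd⟩ := exists_nextAlong hσ hs (c := c) (by simp [Visited, hca])
    obtain ⟨b, hdb, hab⟩ := hd.exists_phase hσ hca
    obtain ⟨-, g, hmove⟩ := hd
    exact ⟨⟨(d, b), hdb⟩, g, ⟨δ, hmove⟩, hab⟩
  choose next out hmove hphase using hnext
  let x (t : ℕ) : Phased := next^[t] ⟨((T.init, 0), a), ha⟩
  have hx : ∀ t, x (t + 1) = next (x t) := fun t => Function.iterate_succ_apply' ..
  refine ⟨fun t => (x t).1.1, fun t => out (x t), fun t => (x t).1.2, rfl, hne, fun t => ?_⟩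
  simp only [hx]
  exact ⟨hmove _, (x t).2, hphase _⟩

theorem exists_eq_of_visited (hT : T.IsDeterministic) (hlab : IsLabelling w σ)
    (hσ : ∀ n, (σ n).Edge (σ (n + 1))) (hwf : WellFounded (Next σ)) {ρ : ℕ → T.State × ℕ}
    {γ : ℕ → List Gam} (h0 : ρ 0 = (T.init, 0))
    (hρ : ∀ t, ∃ δ, Move σ δ (ρ t) (γ t) (ρ (t + 1))) (hc : Visited σ c) : ∃ t, ρ t = c := by
  induction c using hwf.induction with
  | _ c ih =>
    by_cases hinit : c = (T.init, 0)
    · exact ⟨0, h0.trans hinit.symm⟩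
    · obtain ⟨d, δ, hd, g, hmove⟩ := exists_next_of_ne_init hσ hlab.sym hc hinit
      obtain ⟨t, rfl⟩ := ih d ⟨δ, hd, g, hmove⟩ hd
      exact ⟨t + 1, hT.step_unique (hlab.move_iff.1 (hρ t)) (hlab.move_iff.1 ⟨δ, hmove⟩)⟩

theorem exists_traces (hT : T.IsDeterministic) (hσ : ∀ n, (σ n).Edge (σ (n + 1)))
    (hacc : Accepting σ) (hlab : IsLabelling w σ) :
    ∃ ρ γ t₀, T.IsAcceptingRun w ρ γ ∧ Traces σ ρ γ t₀ := by
  obtain ⟨ρ, γ, φ, h0, hφ0, hρ⟩ := exists_run hσ hlab.sym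
  choose hmove hphase hstep using hρ
  have hvisited : ∀ t, Visited σ (ρ t) := fun t => by simp [Visited, hphase]
  have hinj : Function.Injective ρ := injective_of_acyclic (not_transGen_next hσ) fun t =>
    (hmove t).imp fun _ h => ⟨hvisited t, _, h⟩
  have hall : ∀ c, Visited σ c → ∃ t, ρ t = c := fun c =>
    exists_eq_of_visited hT hlab hσ hacc.wellFounded h0 hmove
  have hpast : ∃ t, φ t ≠ .lt := by
    obtain ⟨m, hm⟩ := eventually_atTop.1 hacc.past
    obtain ⟨t, ht⟩ := exists_le_snd_of_injective hinj m
    exact ⟨t, fun hlt => hm _ ht _ (hlt ▸ hphase t)⟩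
  obtain ⟨t₀, ht₀⟩ := CellInfo.phase_eq_of_phaseStep hstep hφ0 hpast
  refine ⟨ρ, γ, t₀, ⟨h0, fun t => hlab.move_iff.1 (hmove t), exists_le_snd_of_injective hinj, ?_⟩,
    hinj, hmove, fun t => ht₀ t ▸ hphase t, hall⟩
  rw [infSet_fst_eq hinj fun c => ⟨hall c, fun ⟨t, ht⟩ => ht ▸ hvisited t⟩]
  exact hacc.muller

end Runs

/-- The labelling of the tape of `w` that records the run with configurations `ρ`, relative to the
step `t₀` and to the position `o` of the letter `b` in its output. -/
noncomputable def runLabelling (w : ℕ → Sig) (ρ : ℕ → T.State × ℕ) (t₀ : ℕ) (o : Fin L) (b : Gam)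
    (n : ℕ) : T.CellInfo L where
  sym := inputTape w n
  letter := b
  ahead := {p | T.AheadHolds w n p}
  behind := T.behindState w n
  phase q := (Function.partialInv ρ (q, n)).map (compare · t₀)
  entered δ := {q | ∃ t, ρ (t + 1) = (q, n) ∧ δ.Moves (ρ t).2 n}
  before q q' := ∃ t t', t < t' ∧ ρ t = (q, n) ∧ ρ t' = (q', n)
  off := o

theorem CellInfo.phaseStep_compare (t t₀ : ℕ) :
    PhaseStep (compare t t₀) (compare (t + 1) t₀) := by
  rw [PhaseStep, compare_lt_iff_lt, compare_le_iff_le, Nat.succ_le_iff]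

section RunLabelling

variable {w : ℕ → Sig} {ρ : ℕ → T.State × ℕ} {γ : ℕ → List Gam} {t₀ : ℕ} {o : Fin L} {b : Gam}
  {c d : T.State × ℕ} {n : ℕ} {q : T.State}

local notation "σ" => runLabelling w ρ t₀ o b

theorem isLabelling_runLabelling : IsLabelling w σ :=
  ⟨fun _ => rfl, fun _ => rfl, fun _ => rfl⟩

theorem phase_runLabelling_eq_some_iff (hρ : Function.Injective ρ) {a : Ordering} :
    (σ n).phase q = some a ↔ ∃ t, ρ t = (q, n) ∧ compare t t₀ = a := by
  simp only [runLabelling, Option.map_eq_some_iff, hρ.isPartialInv _ _]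

theorem visited_runLabelling_iff (hρ : Function.Injective ρ) : Visited σ c ↔ ∃ t, ρ t = c := by
  simp only [Visited, Option.ne_none_iff_exists', phase_runLabelling_eq_some_iff hρ]
  exact ⟨fun ⟨_, t, ht, _⟩ => ⟨t, ht⟩, fun ⟨t, ht⟩ => ⟨_, t, ht, rfl⟩⟩

namespace IsAcceptingRun

theorem move_runLabelling (hr : T.IsAcceptingRun w ρ γ) (t : ℕ) :
    ∃ δ, Move σ δ (ρ t) (γ t) (ρ (t + 1)) :=
  isLabelling_runLabelling.move_iff.2 (hr.step t)

theorem succ_eq_of_move (hr : T.IsAcceptingRun w ρ γ) (hT : T.IsDeterministic) {t : ℕ}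
    (ht : ρ t = c) {δ : HeadDir} {g : List Gam} (h : Move σ δ c g d) : ρ (t + 1) = d :=
  hT.step_unique (hr.step t) (isLabelling_runLabelling.move_iff.1 ⟨δ, ht ▸ h⟩)

theorem output_eq_of_act (hr : T.IsAcceptingRun w ρ γ) (hT : T.IsDeterministic) {t : ℕ}
    (ht : ρ t = (q, n)) {q' : T.State} {g : List Gam} {δ : HeadDir}
    (h : (σ n).Act q (q', g, δ)) : g = γ t := by
  obtain ⟨δ', hact, -⟩ := hr.move_runLabelling (t₀ := t₀) (o := o) (b := b) t
  rw [ht] at hact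
  have heq := isLabelling_runLabelling.act_unique hT h hact
  simp only [Prod.mk.injEq] at heq
  exact heq.2.1

theorem traces_runLabelling (hr : T.IsAcceptingRun w ρ γ) (hT : T.IsDeterministic) :
    Traces σ ρ γ t₀ where
  injective := hr.injective hT
  move := hr.move_runLabelling
  phase t := (phase_runLabelling_eq_some_iff (hr.injective hT)).2 ⟨t, rfl, rfl⟩
  exists_of_visited _ := (visited_runLabelling_iff (hr.injective hT)).1

theorem valid_runLabelling (hr : T.IsAcceptingRun w ρ γ) (hT : T.IsDeterministic)
    (ho : (γ t₀)[(o : ℕ)]? = some b) (n : ℕ) : (σ n).Valid := by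
  have hinj := hr.injective hT
  have hsym : (σ n).sym = none ↔ n = 0 := inputTape_eq_none_iff
  have hvisited : ∀ q, (σ n).phase q ≠ none → ∃ t, ρ t = (q, n) :=
    fun q hq => (visited_runLabelling_iff (c := (q, n)) hinj).1 hq
  refine ⟨fun h => ?_, fun q hq => ?_, fun h => ?_, fun q hq => ?_, fun h => ?_, ?_, ?_, ?_⟩
  · obtain rfl := hsym.1 h
    rfl
  · obtain ⟨t, ht⟩ := hvisited q hq
    obtain ⟨δ, hmove⟩ := hr.move_runLabelling (t₀ := t₀) (o := o) (b := b) t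
    rw [ht] at hmove
    refine ⟨_, _, δ, hmove.1, fun h => ?_⟩
    cases δ with
    | right => rfl
    | left => exact absurd (hmove.2.symm.trans (hsym.1 h)) (Nat.succ_ne_zero _)
  · obtain rfl := hsym.1 h
    exact ⟨_, (phase_runLabelling_eq_some_iff hinj).2 ⟨0, hr.start, rfl⟩,
      compare_le_iff_le.2 (Nat.zero_le _)⟩
  · obtain ⟨_ | t, ht⟩ := hvisited q hq
    · have hstart := hr.start.symm.trans ht
      exact .inl ⟨hsym.2 (congrArg Prod.snd hstart).symm, (congrArg Prod.fst hstart).symm⟩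
    · obtain ⟨δ, -, hmoves⟩ := hr.move_runLabelling (t₀ := t₀) (o := o) (b := b) t
      rw [ht] at hmoves
      exact .inr ⟨δ, t, ht, hmoves⟩
  · exact Set.eq_empty_of_forall_notMem fun q ⟨t, _, ht⟩ =>
      Nat.succ_ne_zero _ (ht.symm.trans (hsym.1 h))
  · rintro q ⟨t, t', hlt, ht, ht'⟩
    exact hlt.ne (hinj (ht.trans ht'.symm))
  · rintro q q' q'' ⟨t, t', htt', ht, ht'⟩ ⟨s, s', hss', hs, hs'⟩
    obtain rfl := hinj (ht'.trans hs.symm)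
    exact ⟨t, s', htt'.trans hss', ht, hs'⟩
  · intro q q' g δ hq hact
    obtain ⟨t, ht, htt₀⟩ := (phase_runLabelling_eq_some_iff hinj).1 hq
    obtain rfl := compare_eq_iff_eq.1 htt₀
    exact hr.output_eq_of_act hT ht hact ▸ ho

theorem link_runLabelling (hr : T.IsAcceptingRun w ρ γ) (hT : T.IsDeterministic) {δ : HeadDir}
    {m n : ℕ} (hmn : δ.Moves m n) : CellInfo.Link δ (σ m) (σ n) := by
  have hinj := hr.injective hT
  have hvisited : ∀ k q, (σ k).phase q ≠ none → ∃ t, ρ t = (q, k) :=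
    fun k q hq => (visited_runLabelling_iff (c := (q, k)) hinj).1 hq
  refine ⟨fun q q' g a hq hact => ?_, ?_, ?_⟩
  · obtain ⟨t, ht, rfl⟩ := (phase_runLabelling_eq_some_iff hinj).1 hq
    exact ⟨_, (phase_runLabelling_eq_some_iff hinj).2
      ⟨t + 1, hr.succ_eq_of_move hT ht ⟨hact, hmn⟩, rfl⟩, CellInfo.phaseStep_compare t t₀⟩
  · rintro q ⟨t, ht, hmoves⟩ -
    obtain rfl : (ρ t).2 = m :=
      (HeadDir.moves_opposite.2 hmoves).right_unique (HeadDir.moves_opposite.2 hmn)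
    obtain ⟨δ', hact, hmoves'⟩ := hr.move_runLabelling (t₀ := t₀) (o := o) (b := b) t
    rw [ht] at hact hmoves'
    obtain rfl := hmoves.dir_unique hmoves'
    exact ⟨(ρ t).1, γ t, (visited_runLabelling_iff hinj).2 ⟨t, rfl⟩, hact⟩
  · intro q₁ q₂ q₃ q₄ g g' hq₁ hq₃ hact hact' h
    obtain ⟨t, ht⟩ := hvisited m q₁ hq₁
    obtain ⟨t', ht'⟩ := hvisited n q₃ hq₃
    have hsucc := hr.succ_eq_of_move hT ht (d := (q₂, n)) ⟨hact, hmn⟩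
    have hsucc' := hr.succ_eq_of_move hT ht' (d := (q₄, m))
      ⟨hact', HeadDir.moves_opposite.2 hmn⟩
    refine ⟨t, t' + 1, ?_, ht, hsucc'⟩
    rcases h with rfl | ⟨s, s', hlt, hs, hs'⟩
    · obtain rfl := hinj (hsucc.trans ht'.symm)
      omega
    · obtain rfl := hinj (hsucc.trans hs.symm)
      obtain rfl := hinj (ht'.trans hs'.symm)
      omega

theorem edge_runLabelling (hr : T.IsAcceptingRun w ρ γ) (hT : T.IsDeterministic)
    (ho : (γ t₀)[(o : ℕ)]? = some b) (n : ℕ) : (σ n).Edge (σ (n + 1)) where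
  valid := hr.valid_runLabelling hT ho n
  sym := Option.some_ne_none _
  letter := rfl
  ahead := Set.ext fun p => aheadHolds_iff w n p
  behind := behindState_succ w n
  right := hr.link_runLabelling hT rfl
  left := hr.link_runLabelling hT rfl

theorem wellFounded_next_runLabelling (hr : T.IsAcceptingRun w ρ γ) (hT : T.IsDeterministic) :
    WellFounded (Next σ) := by
  have hinj := hr.injective hT
  refine Subrelation.wf ?_ (measure (Function.invFun ρ)).wf
  rintro c d ⟨δ, hc, g, hmove⟩
  obtain ⟨t, rfl⟩ := (visited_runLabelling_iff hinj).1 hc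
  obtain rfl := hr.succ_eq_of_move hT rfl hmove
  change Function.invFun ρ (ρ t) < Function.invFun ρ (ρ (t + 1))
  simp only [Function.leftInverse_invFun hinj _, Nat.lt_succ_self]

theorem accepting_runLabelling (hr : T.IsAcceptingRun w ρ γ) (hT : T.IsDeterministic) :
    Accepting σ := by
  have hinj := hr.injective hT
  refine ⟨hr.wellFounded_next_runLabelling hT, .of_forall fun _ => rfl, ?_, ?_⟩
  · rw [← infSet_fst_eq hinj fun _ => visited_runLabelling_iff hinj]
    exact hr.muller
  · have hbound : ∀ᶠ n in atTop, ∀ t ∈ Finset.range t₀, (ρ t).2 < n :=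
      (Filter.eventually_all_finset _).2 fun t _ => eventually_gt_atTop _
    filter_upwards [hbound] with n hn q hq
    obtain ⟨t, ht, hlt⟩ := (phase_runLabelling_eq_some_iff hinj).1 hq
    exact (hn t (Finset.mem_range.2 (compare_lt_iff_lt.1 hlt))).ne (congrArg Prod.snd ht)

end IsAcceptingRun

end RunLabelling

variable (T) in
theorem exists_output_bound [Finite Sig] :
    ∃ L, ∀ q a p s r, T.trans q a p s = some r → r.2.1.length < L := by
  have := T.finState
  have := T.finAhead
  have := T.finBehind
  obtain ⟨L, hL⟩ := (Set.finite_range fun z : T.State × Option Sig × T.Ahead × T.Behind =>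
    (T.trans z.1 z.2.1 z.2.2.1 z.2.2.2).elim 0 fun r => r.2.1.length).bddAbove
  exact ⟨L + 1, fun q a p s r h => Nat.lt_succ_of_le (hL ⟨(q, a, p, s), by simp [h]⟩)⟩

theorem Step.length_lt {w : ℕ → Sig} {c d : T.State × ℕ} {g : List Gam} (h : T.Step w c g d)
    (hL : ∀ q a p s r, T.trans q a p s = some r → r.2.1.length < L) : g.length < L := by
  obtain ⟨δ, ⟨p, -, hr⟩, -⟩ := step_iff.1 h
  exact hL _ _ _ _ _ hr

theorem Realizes.describes {f : (ℕ → Sig) →. (ℕ → Gam)} (hf : T.Realizes f)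
    (hT : T.IsDeterministic) (hL : ∀ q a p s r, T.trans q a p s = some r → r.2.1.length < L) :
    (T.pathSystem L).Describes f := by
  intro w i b
  constructor
  · rintro ⟨y, hy, rfl⟩
    obtain ⟨ρ, γ, hr⟩ := (hf.1 w).1 (Part.dom_iff_mem.2 ⟨y, hy⟩)
    obtain ⟨t₀, o, hi, ho⟩ := (hf.2 w ρ γ hr y hy).exists_index i
    have hoL : o < L := (List.getElem?_eq_some_iff.1 ho).1.trans ((hr.step t₀).length_lt hL)
    have htotal := (hr.traces_runLabelling hT (t₀ := t₀) (o := ⟨o, hoL⟩) (b := y i)).hasTotal hT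
      isLabelling_runLabelling
    exact ⟨runLabelling w ρ t₀ ⟨o, hoL⟩ (y i), ⟨hr.edge_runLabelling hT ho,
      hr.accepting_runLabelling hT, hi ▸ htotal⟩, fun _ => rfl, rfl⟩
  · rintro ⟨σ, ⟨hσ, hacc, htotal⟩, hs, rfl⟩
    have hlab : IsLabelling w σ :=
      ⟨hs, ahead_eq_of_edges hσ hacc.ahead hs, behind_eq_of_edges hσ hs⟩
    obtain ⟨ρ, γ, t₀, hr, hρ⟩ := exists_traces hT hσ hacc hlab
    have hdom : w ∈ f.Dom := (hf.1 w).2 ⟨ρ, γ, hr⟩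
    have hletter : ∀ n, (σ n).letter = (σ 0).letter :=
      PathSystem.letter_eq_letter_zero (N := T.pathSystem L) hσ
    have hb : (γ t₀)[((σ (ρ t₀).2).off : ℕ)]? = some (σ 0).letter := by
      obtain ⟨δ, hact, -⟩ := hρ.move t₀
      rw [← hletter (ρ t₀).2]
      exact (hσ _).valid.letter_off _ _ _ _ (by rw [hρ.phase, compare_eq_iff_eq.2 rfl]) hact
    obtain ⟨n, hn, hn'⟩ := (htotal.and (hρ.hasTotal hT hlab)).exists
    refine ⟨_, Part.get_mem hdom, ?_⟩
    rw [← hn, hn']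
    exact (hf.2 w ρ γ hr _ (Part.get_mem hdom)).apply_eq hb

end TwoWayTransducer

theorem IsRegularFunction.exists_describes {Sig Gam : Type*} [Finite Sig] [Finite Gam]
    {f : (ℕ → Sig) →. (ℕ → Gam)} (hf : IsRegularFunction f) :
    ∃ (K : ℕ) (N : PathSystem Sig Gam (Fin K)), N.Describes f := by
  obtain ⟨T, hT, hf⟩ := hf
  obtain ⟨L, hL⟩ := T.exists_output_bound
  exact ⟨_, _, (hf.describes hT hL).map (Finite.equivFin _)⟩

theorem theorem2 {Sig Gam : Type*} [Finite Sig] [Finite Gam]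
    [TopologicalSpace Sig] [DiscreteTopology Sig] [TopologicalSpace Gam] [DiscreteTopology Gam]
    (f : (ℕ → Sig) →. (ℕ → Gam)) (hf : IsRegularFunction f) :
    (IsComputableFunction f ↔ Continuous f.asSubtype) ∧ MismatchDecidable f := by
  obtain ⟨K, N, hN⟩ := hf.exists_describes
  exact ⟨⟨fun h => h.continuous, fun h => hN.isComputableFunction (continuous_asSubtype_iff.1 h)⟩,
    hN.mismatchDecidable⟩
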